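/- For $n\ge 1$ let $S_n$ be the group of permutations of $[n]=\{1,\dots,n\}$ under composition, with $\sigma\in S_n$ also written as the vector $[\sigma(1),\dots,\sigma(n)]$. For $1\le j\le n$ let $t_{\uparrow j}:S_n\to S_n$ be the (bijective) push-to-the-top map $$t_{\uparrow j}([a_1,\dots,a_{j-1},a_j,a_{j+1},\dots,a_n])=[a_j,a_1,\dots,a_{j-1},a_{j+1},\dots,a_n].$$ A $G_\uparrow(n,M)$ code is a sequence $(c_1,\dots,c_M)$ of $M\ge 1$ pairwise distinct elements of $S_n$ such that each of $c_2,\dots,c_M$ is obtained from its predecessor, and $c_1$ from $c_M$, by applying some $t_{\uparrow j}$ with $2\le j\le n$. It is parity-preserving if all its elements have the same sign. Fix $m\ge 2$. On $S_{2m+2}$ put $\varphi=t_{\uparrow 2m+2}^{\,2}\circ t_{\uparrow 2m-1}^{-1}$, and for $r\ge 0$ put $$\hat\pi_r=\varphi^r(\mathrm{id}),\qquad \tilde\sigma_r=\bigl(t_{\uparrow 2m+2}^{-1}\hat\pi_r\bigr)\circ(2m+1,\,2m+2).$$ **Theorem.** For all $r\ge 0$ there exists a parity-preserving $G_\uparrow\bigl(2m+2,\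 \tfrac{(2m+1)!}{2}-(2m-1)\bigr)$ code $\hat P_r$ such that: 1. the first permutation in $\hat P_r$ is $\hat\pi_r$; 2. the last permutation in $\hat P_r$ is $t_{\uparrow 2m-1}^{-1}\hat\pi_r$; 3. every $\pi\in\hat P_r$ satisfies $$\pi(2m+2)=\hat\pi_r(2m+2)=\begin{cases}2m+2 & r\equiv 0 \pmod{2m},\\ 2m+1-(r\bmod 2m) & r\not\equiv 0\pmod{2m};\end{cases}$$ 4. $\tilde\sigma_r\notin\hat P_r$. Moreover $\tilde\sigma_r=t_{\uparrow 2m+1}^{-1}(\hat\pi_r)$, and in particular $\tilde\sigma_r(2m+2)=\hat\pi_r(2m+2)$. -/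

import Mathlib

/-!
Permutations of `[n] = {1, …, n}` are modelled by `Equiv.Perm (Fin n)`, the element `i ∈ [n]`
being `i - 1 : Fin n`.  The vector notation `[σ(1), …, σ(n)]` is the list of values of `σ`, and
products are compositions, `(σ * τ) k = σ (τ k)`.
-/

namespace RankMod

open Equiv

/-- The push-to-the-top transition on an index, as a bijection of `S_n` onto itself: it sends
`[a_1, …, a_{j-1}, a_j, a_{j+1}, …, a_n]` to `[a_j, a_1, …, a_{j-1}, a_{j+1}, …, a_n]`
(see the three lemmas below).  With `j : Fin n` this is the transition on the index `j + 1`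
of `[n]`. -/
def pushToTop {n : ℕ} (j : Fin n) : Perm (Perm (Fin n)) :=
  Equiv.mulRight (Fin.cycleRange j)⁻¹

theorem pushToTop_apply {n : ℕ} (j : Fin n) (σ : Perm (Fin n)) (k : Fin n) :
    pushToTop j σ k = σ ((Fin.cycleRange j).symm k) := rfl

theorem pushToTop_apply_zero {n : ℕ} [NeZero n] (j : Fin n) (σ : Perm (Fin n)) :
    pushToTop j σ 0 = σ j := by
  rw [pushToTop_apply, Fin.cycleRange_symm_zero]

theorem pushToTop_apply_succ {n : ℕ} (j : Fin n) (σ : Perm (Fin n)) (k l : Fin n)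
    (hl : (l : ℕ) + 1 = k) (hk : k ≤ j) : pushToTop j σ k = σ l := by
  have : NeZero n := ⟨by have := j.2; omega⟩
  have hlj : l < j := by rw [Fin.lt_def]; rw [Fin.le_def] at hk; omega
  have h : (Fin.cycleRange j) l = k := by
    apply Fin.ext
    rw [Fin.coe_cycleRange_of_lt hlj, hl]
  rw [pushToTop_apply, ← h, Equiv.symm_apply_apply]

theorem pushToTop_apply_of_gt {n : ℕ} (j : Fin n) (σ : Perm (Fin n)) (k : Fin n)
    (hk : j < k) : pushToTop j σ k = σ k := by
  have h : (Fin.cycleRange j) k = k := Fin.cycleRange_of_gt hk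
  rw [pushToTop_apply]
  conv_lhs => rw [← h]
  rw [Equiv.symm_apply_apply]

/-- A `T`-Gray code over `S`: a sequence of pairwise distinct elements in which each element
is followed by its image under some transition in `T`. -/
structure IsGrayCode {S : Type*} (T : Set (S → S)) (C : List S) : Prop where
  nodup : C.Nodup
  step : C.IsChain (fun x y => ∃ t ∈ T, y = t x)

/-- A Gray code is cyclic if its last element is moreover sent to its first one by some
transition in `T`. -/
structure IsCyclicGrayCode {S : Type*} (T : Set (S → S)) (C : List S) : Prop
    extends IsGrayCode T C where
  cyclic : ∃ h : C ≠ [], ∃ t ∈ T, C.head h = t (C.getLast h)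

/-- The push-to-the-top transitions on the indices `2, …, n`. -/
def topTransitions (n : ℕ) : Set (Perm (Fin n) → Perm (Fin n)) :=
  {t | ∃ j : Fin n, 0 < (j : ℕ) ∧ t = pushToTop j}

/-- `C` is a `G_↑(n, M)`: a cyclic push-to-the-top Gray code of size `M` in `S_n`. -/
structure IsPushToTopCode (n M : ℕ) (C : List (Perm (Fin n))) : Prop
    extends IsCyclicGrayCode (topTransitions n) C where
  size : C.length = M

/-- All elements of the code have the same sign. -/
def ParityPreserving {n : ℕ} (C : List (Perm (Fin n))) : Prop :=
  ∀ σ ∈ C, ∀ τ ∈ C, Perm.sign σ = Perm.sign τ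

/-- The element `2m - 1` of `[2m + 2]` (for `m ≥ 1`). -/
def idxA (m : ℕ) : Fin (2 * m + 2) := ⟨2 * m - 2, by omega⟩

/-- The element `2m + 1` of `[2m + 2]`. -/
def idxB (m : ℕ) : Fin (2 * m + 2) := ⟨2 * m, by omega⟩

/-- The element `2m + 2` of `[2m + 2]`. -/
def idxC (m : ℕ) : Fin (2 * m + 2) := ⟨2 * m + 1, by omega⟩

/-- `φ = t_{↑2m+2}² ∘ t_{↑2m-1}⁻¹`. -/
def phi (m : ℕ) : Perm (Perm (Fin (2 * m + 2))) :=
  pushToTop (idxC m) ^ 2 * (pushToTop (idxA m))⁻¹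

/-- `π̂_r = φ^r(id)`. -/
def piHat (m r : ℕ) : Perm (Fin (2 * m + 2)) := (phi m ^ r) 1

/-- `σ̃_r = (t_{↑2m+2}⁻¹ π̂_r) ∘ (2m+1, 2m+2)`. -/
def sigmaTilde (m r : ℕ) : Perm (Fin (2 * m + 2)) :=
  (pushToTop (idxC m))⁻¹ (piHat m r) * swap (idxB m) (idxC m)

end RankMod

/-! All the codes are translates of a single one. Transitions act by right multiplication, so left
multiplication by `piHat m r` carries codes to codes, and the last entry is constant as long as only
the indices up to `2m + 1` are used. It therefore suffices (`exists_code`) to work in the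
alternating group on `n = q + 4 = 2m + 1` letters with the two transitions `a = rot q` (index `n`)
and `b = push q` (index `n - 2`), both even because `n` is odd: a cyclic sequence from `1` to `b⁻¹`
is wanted that covers everything except one left coset of `⟨b⟩`, which has `n - 2 = 2m - 1` elements
and contains `a⁻¹`.

Such a sequence is a cycle of a permutation `F` with `F x ∈ {x a, x b}`. Right multiplication by `a`
is the starting point; its cycles are the cosets of `⟨a⟩`. Since `r = b a⁻¹` is a three-cycle
(`push_eq`), bijectivity allows switching from `a` to `b` exactly on whole triples `x, x r, x r²`,
and a switch composes `F` with a three-cycle. If the triple meets three different cycles, they merge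
(`PartialCycle.grow`). Switches preserve the parity of the number of cycles, which starts at the
even number `(n - 1)! / 2`, so a single cycle is impossible. One exceptional cycle is produced by
switching at all elements of a coset of `⟨b⟩`, which then closes up on itself
(`PartialCycle.close`).

The bookkeeping views a coset of `⟨a⟩` as a necklace. Two letters are special; the label `(y, i)`
records the number `i` of beads from the first special letter to the second, and a normalized
arrangement `y` with the special letters at the end. Triples merge labels with the same `y` and `i ≥
1` (`mergeable_chain`), labels `0` along a coset of `⟨b⟩` (`ring_mem`), and different cosets of
`⟨b⟩` (`mergeable_link`). The root coset is treated in `built_root`; the others are attached one at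
a time (`Built.extend`), and all are reached because `b` and a double transposition generate the
alternating group on the other `n - 2` letters (`mem_of_finRotate_mem`).

With `a⁻¹⟨b⟩` as the missing coset, the triple of `a⁻¹` contains `b⁻¹`, so `F b⁻¹ = 1` and the cycle
through `1` ends at `b⁻¹`. -/

namespace RankMod

open Equiv Equiv.Perm

/-! ### Cycles of a permutation multiplied by a transposition. -/

section Merge

variable {V : Type*} [Finite V]

theorem sameCycle_mem {σ : Perm V} {W : Set V} (hW : ∀ w ∈ W, σ w ∈ W) {u v : V}
    (h : SameCycle σ u v) (hu : u ∈ W) : v ∈ W := by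
  obtain ⟨i, rfl⟩ := h.exists_nat_pow_eq
  induction i with
  | zero => simpa using hu
  | succ k ih => rw [pow_succ', mul_apply]; exact hW _ (ih ⟨k, by simp⟩)

variable [DecidableEq V]

omit [Finite V] [DecidableEq V] in
theorem sameCycle_step (σ : Perm V) (x : V) : SameCycle σ x (σ x) := ⟨1, by simp⟩

/-- Multiplying by a transposition splits a cycle into at most two. -/
theorem sameCycle_mul_swap_or {σ : Perm V} {x y z : V}
    (h : SameCycle σ x z) : SameCycle (σ * swap x y) x z ∨ SameCycle (σ * swap x y) y z := by
  set σ' := σ * swap x y with hσ'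
  refine sameCycle_mem (W := {z | SameCycle σ' x z ∨ SameCycle σ' y z}) ?_ h (Or.inl (.refl _ _))
  rintro w hw
  by_cases hwx : w = x
  · subst hwx
    exact Or.inr ⟨1, by simp [hσ']⟩
  by_cases hwy : w = y
  · subst hwy
    exact Or.inl ⟨1, by simp [hσ']⟩
  have : σ w = σ' w := by simp [hσ', swap_apply_of_ne_of_ne hwx hwy]
  simp only [Set.mem_ofPred_eq, this] at hw ⊢
  exact hw.imp (fun h => h.trans (sameCycle_step _ _)) (fun h => h.trans (sameCycle_step _ _))

/-- The new permutation sends `x` to `σ y` and then follows the old cycle of `y`, which avoids `x`,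
until it arrives at `y`. -/
theorem sameCycle_mul_swap_self {σ : Perm V} {x y : V} (hxy : ¬ SameCycle σ x y) :
    SameCycle (σ * swap x y) x y := by
  set σ' := σ * swap x y with hσ'
  have h1 : SameCycle σ' x (σ y) := ⟨1, by simp [hσ']⟩
  refine h1.trans ?_
  have key : ∀ w, SameCycle σ (σ y) w → SameCycle σ y w ∧ SameCycle σ' (σ y) w := by
    intro w hw
    refine sameCycle_mem (W := {w | SameCycle σ y w ∧ SameCycle σ' (σ y) w}) ?_ hw
      ⟨sameCycle_step _ _, .refl _ _⟩
    rintro w ⟨hw1, hw2⟩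
    refine ⟨hw1.trans (sameCycle_step _ _), ?_⟩
    by_cases hwy : w = y
    · subst hwy; exact .refl _ _
    have hwx : w ≠ x := by rintro rfl; exact hxy hw1.symm
    have : σ w = σ' w := by simp [hσ', swap_apply_of_ne_of_ne hwx hwy]
    rw [this]
    exact hw2.trans (sameCycle_step _ _)
  exact (key y (sameCycle_step _ _).symm).2

/-- Multiplying by a transposition of two elements in distinct cycles merges these cycles. -/
theorem sameCycle_mul_swap {σ : Perm V} {x y u v : V} (hxy : ¬ SameCycle σ x y)
    (h : SameCycle σ u v) : SameCycle (σ * swap x y) u v := by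
  have hs := sameCycle_mul_swap_self hxy
  have hx : ∀ w, SameCycle σ x w → SameCycle (σ * swap x y) x w := fun w hw =>
    (sameCycle_mul_swap_or (y := y) hw).elim id hs.trans
  have hy : ∀ w, SameCycle σ y w → SameCycle (σ * swap x y) y w := fun w hw => by
    rw [swap_comm] at hs ⊢
    exact (sameCycle_mul_swap_or (y := x) hw).elim id hs.symm.trans
  by_cases hux : SameCycle σ x u
  · exact (hx u hux).symm.trans (hx v (hux.trans h))
  by_cases huy : SameCycle σ y u
  · exact (hy u huy).symm.trans (hy v (huy.trans h))
  have key := sameCycle_mem (σ := σ)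
    (W := {w | SameCycle σ u w ∧ SameCycle (σ * swap x y) u w}) ?_ h ⟨.refl _ _, .refl _ _⟩
  · exact key.2
  rintro w ⟨hw1, hw2⟩
  refine ⟨hw1.trans (sameCycle_step _ _), hw2.trans ?_⟩
  have h1 : w ≠ x := by rintro rfl; exact hux hw1.symm
  have h2 : w ≠ y := by rintro rfl; exact huy hw1.symm
  exact ⟨1, by simp [swap_apply_of_ne_of_ne h1 h2]⟩

end Merge

/-! ### Successor permutations with two generators, and switching triples. -/

section State

variable {G : Type*} [Group G]

/-- A successor permutation `F` on a group in which every element is followed by its right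
multiple by `a` or `b`, such that `U \ M` lies in one cycle of `F`, the successors outside of `U`
are the multiples by `a`, and the successors in `K ⊇ M` are the multiples by `b`. -/
structure PartialCycle (a b : G) (F : Perm G) (U M K : Set G) : Prop where
  step : ∀ x, F x = x * a ∨ F x = x * b
  outside : ∀ x, x ∉ U → F x = x * a
  mul_right_mem : ∀ x ∈ U, x * a ∈ U
  triple : ∀ x, F x = x * b → F (x * (b * a⁻¹)) = x * (b * a⁻¹) * b
  fixed : ∀ x ∈ K, F x = x * b
  missing : ∀ x ∈ M, x ∈ U ∧ x ∈ K ∧ x * b ∈ M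
  conn : ∀ x ∈ U, x ∉ M → ∀ y ∈ U, y ∉ M → SameCycle F x y

variable {a b : G} {F : Perm G} {U M K : Set G}

theorem PartialCycle.mono (h : PartialCycle a b F U M K) {K' : Set G} (hK : K' ⊆ K)
    (hM : M ⊆ K') : PartialCycle a b F U M K' :=
  { h with
    fixed := fun x hx => h.fixed x (hK hx)
    missing := fun x hx => ⟨(h.missing x hx).1, hM hx, (h.missing x hx).2.2⟩ }

variable [Finite G]

/-- In a finite group, closure under right multiplication by `a` already gives closure under `a⁻¹`.
-/
theorem mul_mem_of_closed {a : G} {U : Set G} (h : ∀ x ∈ U, x * a ∈ U) {x c : G}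
    (hc : c ∈ Subgroup.zpowers a) : x * c ∈ U ↔ x ∈ U := by
  have key : ∀ c ∈ Subgroup.zpowers a, ∀ x ∈ U, x * c ∈ U := by
    intro c hc x hx
    have : SameCycle (Equiv.mulRight a) x (x * c) := by
      obtain ⟨i, rfl⟩ := hc
      exact ⟨i, by simp⟩
    exact sameCycle_mem (W := U) (fun w hw => h w hw) this hx
  refine ⟨fun hx => ?_, key c hc x⟩
  simpa using key c⁻¹ (inv_mem hc) _ hx

-- If `x * b` left `U`, then so would `x r`, because `x r a = x b`. But outside `U` the successor is
-- the multiple by `a`, whereas `triple` demands the multiple by `b`.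
omit [Finite G] in
theorem PartialCycle.closed (hab : a ≠ b) (h : PartialCycle a b F U M K) :
    ∀ x ∈ U, F x ∈ U := by
  intro x hx
  rcases h.step x with h1 | h1
  · rw [h1]; exact h.mul_right_mem x hx
  · by_contra hc
    have h2 := h.triple x h1
    have h3 : x * (b * a⁻¹) ∉ U := fun h3 => hc (by
      have := h.mul_right_mem _ h3
      rw [h1]; simpa [mul_assoc] using this)
    rw [h.outside _ h3] at h2
    exact hab (mul_left_cancel h2)

/-- Only the behaviour of `σ` on the coset of `x` enters, so this applies to every coset still
untouched by switches. -/
theorem PartialCycle.orbit {σ : Perm G} {x : G}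
    (h : ∀ c ∈ Subgroup.zpowers a, σ (x * c) = x * c * a) {c : G}
    (hc : c ∈ Subgroup.zpowers a) : SameCycle σ x (x * c) := by
  obtain ⟨i, rfl⟩ := (mem_powers_iff_mem_zpowers (x := a)).2 hc
  refine ⟨i, ?_⟩
  induction i with
  | zero => simp
  | succ k ih =>
    have ih := ih (Subgroup.npow_mem_zpowers _ _)
    simp only [zpow_natCast] at ih ⊢
    rw [pow_succ', mul_apply, ih, h _ (Subgroup.npow_mem_zpowers _ _)]
    simp [pow_succ, mul_assoc]

theorem PartialCycle.init (hab : a ≠ b) (u : G) :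
    PartialCycle a b (Equiv.mulRight a) {x | ∃ c ∈ Subgroup.zpowers a, x = u * c} ∅ ∅ where
  step x := Or.inl rfl
  outside x _ := rfl
  mul_right_mem := by
    rintro _ ⟨c, hc, rfl⟩
    exact ⟨c * a, mul_mem hc (Subgroup.mem_zpowers a), by group⟩
  triple x hx := absurd (mul_left_cancel hx) hab
  fixed := by simp
  missing := by simp
  conn := by
    rintro _ ⟨c, hc, rfl⟩ - _ ⟨d, hd, rfl⟩ -
    exact (orbit (fun c _ => rfl) hc).symm.trans (orbit (fun c _ => rfl) hd)

/-- The three-cycle `x ↦ x r ↦ x r² ↦ x` (for `r³ = 1`). -/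
def tripleCycle [DecidableEq G] (x r : G) : Perm G :=
  swap x (x * r) * swap (x * r) (x * r * r)

section Triple

variable [DecidableEq G] {x r : G}

omit [Finite G] [DecidableEq G] in
theorem triple_ne (hr : r ^ 3 = 1) (hr1 : r ≠ 1) :
    x ≠ x * r ∧ x ≠ x * r * r ∧ x * r ≠ x * r * r := by
  refine ⟨fun h => hr1 (by simpa using h), fun h => hr1 ?_, fun h => hr1 (by simpa using h)⟩
  have h2 : r * r = 1 := by simpa [mul_assoc] using h
  rw [pow_succ, pow_two, h2, one_mul] at hr
  exact hr

omit [Finite G] [DecidableEq G] in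
theorem triple_pow (hr : r ^ 3 = 1) : x * r * r * r = x := by
  rw [mul_assoc, mul_assoc, ← mul_assoc r, ← pow_two, ← pow_succ, hr, mul_one]

-- The second factorization serves `PartialCycle.close`, where the transposition that merges has to
-- come before the one that splits.
omit [Finite G] in
theorem tripleCycle_eq (hr : r ^ 3 = 1) (hr1 : r ≠ 1) :
    tripleCycle x r = swap (x * r) (x * r * r) * swap x (x * r * r) := by
  obtain ⟨h1, h2, h3⟩ := triple_ne (x := x) hr hr1
  ext w
  simp only [tripleCycle, mul_apply]
  by_cases hw1 : w = x
  · subst hw1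
    rw [swap_apply_of_ne_of_ne h1 h2, swap_apply_left, swap_apply_left, swap_apply_right]
  by_cases hw2 : w = x * r
  · subst hw2
    rw [swap_apply_left, swap_apply_of_ne_of_ne h2.symm h3.symm, swap_apply_of_ne_of_ne hw1 h3,
      swap_apply_left]
  by_cases hw3 : w = x * r * r
  · subst hw3
    rw [swap_apply_right, swap_apply_right, swap_apply_right, swap_apply_of_ne_of_ne h1 h2]
  · rw [swap_apply_of_ne_of_ne hw2 hw3, swap_apply_of_ne_of_ne hw1 hw2,
      swap_apply_of_ne_of_ne hw1 hw3, swap_apply_of_ne_of_ne hw2 hw3]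

omit [Finite G] in
theorem tripleCycle_apply (hr : r ^ 3 = 1) (hr1 : r ≠ 1) :
    tripleCycle x r x = x * r ∧ tripleCycle x r (x * r) = x * r * r ∧
      tripleCycle x r (x * r * r) = x ∧
      ∀ w, w ≠ x → w ≠ x * r → w ≠ x * r * r → tripleCycle x r w = w := by
  obtain ⟨h1, h2, h3⟩ := triple_ne (x := x) hr hr1
  refine ⟨?_, ?_, ?_, fun w hw1 hw2 hw3 => ?_⟩
  · simp only [tripleCycle, mul_apply]
    rw [swap_apply_of_ne_of_ne h1 h2, swap_apply_left]
  · simp only [tripleCycle, mul_apply]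
    rw [swap_apply_left, swap_apply_of_ne_of_ne h2.symm h3.symm]
  · simp only [tripleCycle, mul_apply]
    rw [swap_apply_right, swap_apply_right]
  · simp only [tripleCycle, mul_apply]
    rw [swap_apply_of_ne_of_ne hw2 hw3, swap_apply_of_ne_of_ne hw1 hw2]

omit [Finite G] in
/-- The local effect of replacing the three successors `x a, x r a, x r² a`, `r = b a⁻¹`,
by `x b, x r b, x r² b`. -/
theorem PartialCycle.mul_tripleCycle (hr : (b * a⁻¹) ^ 3 = 1) (hab : a ≠ b)
    (h : PartialCycle a b F U M K) {r : G} (hrd : r = b * a⁻¹)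
    (hx : F x = x * a) (hxr : F (x * r) = x * r * a) (hxrr : F (x * r * r) = x * r * r * a) :
    (∀ w, w ≠ x → w ≠ x * r → w ≠ x * r * r → (F * tripleCycle x r) w = F w) ∧
    (∀ w, w = x ∨ w = x * r ∨ w = x * r * r → (F * tripleCycle x r) w = w * b) ∧
    (∀ w, (F * tripleCycle x r) w = w * a ∨ (F * tripleCycle x r) w = w * b) ∧
    (∀ w, (F * tripleCycle x r) w = w * b → (F * tripleCycle x r) (w * r) = w * r * b) ∧
    (∀ w ∈ K, (F * tripleCycle x r) w = w * b) := by
  have hr1 : r ≠ 1 := fun h1 => hab (by rw [hrd, mul_inv_eq_one] at h1; exact h1.symm)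
  rw [← hrd] at hr
  have hra : ∀ y, y * r * a = y * b := fun y => by rw [hrd]; group
  obtain ⟨c1, c2, c3, c4⟩ := tripleCycle_apply (x := x) hr hr1
  have A : ∀ w, w ≠ x → w ≠ x * r → w ≠ x * r * r → (F * tripleCycle x r) w = F w :=
    fun w h1 h2 h3 => by rw [mul_apply, c4 w h1 h2 h3]
  -- Each point of the triple takes over the old successor of the next one, and `w r a = w b`.
  have B : ∀ w, w = x ∨ w = x * r ∨ w = x * r * r → (F * tripleCycle x r) w = w * b := by
    rintro w (rfl | rfl | rfl)
    · rw [mul_apply, c1, hxr, hra]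
    · rw [mul_apply, c2, hxrr, hra]
    · rw [mul_apply, c3, hx, ← hra, triple_pow hr]
  have hF : ∀ w, w = x ∨ w = x * r ∨ w = x * r * r → F w = w * a := by
    rintro w (rfl | rfl | rfl) <;> assumption
  refine ⟨A, B, fun w => ?_, fun w hw => ?_, fun w hw => ?_⟩
  · by_cases hw : w = x ∨ w = x * r ∨ w = x * r * r
    · exact Or.inr (B w hw)
    · push Not at hw
      rw [A w hw.1 hw.2.1 hw.2.2]
      exact h.step w
  · by_cases hwr : w = x ∨ w = x * r ∨ w = x * r * r
    · apply B
      rcases hwr with rfl | rfl | rfl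
      · exact Or.inr (Or.inl rfl)
      · exact Or.inr (Or.inr rfl)
      · exact Or.inl (triple_pow hr)
    · have hwr' : ¬ (w * r = x ∨ w * r = x * r ∨ w * r = x * r * r) := by
        rintro (h1 | h1 | h1)
        · exact hwr (Or.inr (Or.inr (by rw [← h1, triple_pow hr])))
        · exact hwr (Or.inl (mul_right_cancel h1))
        · exact hwr (Or.inr (Or.inl (mul_right_cancel h1)))
      push Not at hwr hwr'
      rw [A _ hwr.1 hwr.2.1 hwr.2.2] at hw
      rw [A _ hwr'.1 hwr'.2.1 hwr'.2.2]
      have := h.triple w hw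
      rwa [← hrd] at this
  · have hwb := h.fixed w hw
    by_cases hwr : w = x ∨ w = x * r ∨ w = x * r * r
    · exact B w hwr
    · push Not at hwr
      rw [A w hwr.1 hwr.2.1 hwr.2.2, hwb]

/-- A triple with one element in `U` merges two further cycles of right multiplication by `a`. -/
theorem PartialCycle.grow (hr : (b * a⁻¹) ^ 3 = 1) (hab : a ≠ b)
    (h : PartialCycle a b F U M K) {r : G} (hrd : r = b * a⁻¹)
    (hx : x ∈ U) (hxr : x * r ∉ U) (hxrr : x * r * r ∉ U)
    (hne : ∀ c ∈ Subgroup.zpowers a, x * r * r ≠ x * r * c) :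
    PartialCycle a b (F * tripleCycle x r)
      {w | w ∈ U ∨ ∃ c ∈ Subgroup.zpowers a, w = x * r * c ∨ w = x * r * r * c} M
      (K ∪ {x, x * r, x * r * r}) := by
  have hF : F x = x * a := by
    rcases h.step x with h1 | h1
    · exact h1
    · have h2 := h.triple x h1
      rw [← hrd, h.outside _ hxr] at h2
      exact absurd (mul_left_cancel h2) hab
  have hU := fun {x c} => mul_mem_of_closed h.mul_right_mem (x := x) (c := c)
  obtain ⟨A, B, C, D, E⟩ := h.mul_tripleCycle hr hab hrd hF (h.outside _ hxr) (h.outside _ hxrr)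
  have hxM : x ∉ M := fun hm => hab (mul_left_cancel (a := x) (by
    rw [← hF, h.fixed x (h.missing x hm).2.1]))
  have n1 : ¬ SameCycle F x (x * r) := fun hs => hxr (sameCycle_mem (h.closed hab) hs hx)
  -- The coset of `x r²` contains neither `x` nor `x r`, so the first transposition leaves it
  -- closed.
  have n2 : ¬ SameCycle (F * swap x (x * r)) (x * r) (x * r * r) := by
    intro hs
    have hW : ∀ w ∈ {w | ∃ c ∈ Subgroup.zpowers a, w = x * r * r * c},
        (F * swap x (x * r)) w ∈ {w | ∃ c ∈ Subgroup.zpowers a, w = x * r * r * c} := by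
      rintro _ ⟨c, hc, rfl⟩
      have h1 : x * r * r * c ≠ x := fun h1 => hxrr ((hU hc).1 (by rwa [h1]))
      have h2 : x * r * r * c ≠ x * r := fun h2 =>
        hne c⁻¹ (inv_mem hc) (by rw [eq_mul_inv_iff_mul_eq]; exact h2)
      refine ⟨c * a, mul_mem hc (Subgroup.mem_zpowers a), ?_⟩
      rw [mul_apply, swap_apply_of_ne_of_ne h1 h2, h.outside _ (fun h3 => hxrr ((hU hc).1 h3)),
        mul_assoc]
    obtain ⟨c, hc, h1⟩ := sameCycle_mem hW hs.symm ⟨1, one_mem _, by simp⟩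
    exact hne c⁻¹ (inv_mem hc) (by rw [eq_mul_inv_iff_mul_eq]; exact h1.symm)
  have T : ∀ {u v}, SameCycle F u v → SameCycle (F * tripleCycle x r) u v := fun huv => by
    rw [tripleCycle, ← mul_assoc]
    exact sameCycle_mul_swap n2 (sameCycle_mul_swap n1 huv)
  have T1 : SameCycle (F * tripleCycle x r) x (x * r) := by
    rw [tripleCycle, ← mul_assoc]
    exact sameCycle_mul_swap n2 (sameCycle_mul_swap_self n1)
  have T2 : SameCycle (F * tripleCycle x r) (x * r) (x * r * r) := by
    rw [tripleCycle, ← mul_assoc]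
    exact sameCycle_mul_swap_self n2
  have key : ∀ w, (w ∈ U ∨ ∃ c ∈ Subgroup.zpowers a, w = x * r * c ∨ w = x * r * r * c) →
      w ∉ M → SameCycle (F * tripleCycle x r) x w := by
    rintro w (hw | ⟨c, hc, rfl | rfl⟩) hwM
    · exact T (h.conn x hx hxM w hw hwM)
    · exact T1.trans (T (orbit (fun c hc => h.outside _ (fun h3 => hxr ((hU hc).1 h3))) hc))
    · exact T1.trans (T2.trans
        (T (orbit (fun c hc => h.outside _ (fun h3 => hxrr ((hU hc).1 h3))) hc)))
  refine ⟨C, fun w hw => ?_, ?_, fun w hw => ?_, ?_, fun w hw => ?_, ?_⟩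
  · simp only [Set.mem_ofPred_eq, not_or, not_exists, not_and] at hw
    have h1 : w ≠ x := by rintro rfl; exact hw.1 hx
    have h2 : w ≠ x * r := fun h2 => (hw.2 1 (one_mem _)).1 (by simpa using h2)
    have h3 : w ≠ x * r * r := fun h3 => (hw.2 1 (one_mem _)).2 (by simpa using h3)
    rw [A w h1 h2 h3, h.outside w hw.1]
  · rintro w (hw | ⟨c, hc, rfl | rfl⟩)
    · exact Or.inl (h.mul_right_mem w hw)
    · exact Or.inr ⟨c * a, mul_mem hc (Subgroup.mem_zpowers a), Or.inl (by group)⟩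
    · exact Or.inr ⟨c * a, mul_mem hc (Subgroup.mem_zpowers a), Or.inr (by group)⟩
  · rw [← hrd]; exact D w hw
  · rintro w (hw | hw)
    · exact E w hw
    · exact B w hw
  · obtain ⟨h1, h2, h3⟩ := h.missing w hw
    exact ⟨Or.inl h1, Or.inl h2, h3⟩
  · intro w hw hwM z hz hzM
    exact (key w hw hwM).symm.trans (key z hz hzM)

/-- A triple with two elements in `U` and one in a further cycle of right multiplication by `a`,
which closes a coset of `⟨b⟩` into a cycle of its own. -/
theorem PartialCycle.close (hr : (b * a⁻¹) ^ 3 = 1) (hab : a ≠ b)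
    (h : PartialCycle a b F U ∅ K) {r : G} (hrd : r = b * a⁻¹)
    (hx : x ∈ U) (hxr : x * r ∈ U) (hxrr : x * r * r ∉ U)
    (hM : ∀ w ∈ M, w ∈ U ∧ w * b ∈ M) (hxM : x ∈ M) (hMK : ∀ w ∈ M, w = x ∨ w ∈ K) :
    PartialCycle a b (F * tripleCycle x r)
      {w | w ∈ U ∨ ∃ c ∈ Subgroup.zpowers a, w = x * r * r * c} M
      M := by
  have hr1 : r ≠ 1 := fun h1 => hab (by rw [hrd, mul_inv_eq_one] at h1; exact h1.symm)
  have hr3 : r ^ 3 = 1 := by rwa [hrd]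
  have hFr : F (x * r) = x * r * a := by
    rcases h.step (x * r) with h1 | h1
    · exact h1
    · have h2 := h.triple _ h1
      rw [← hrd, h.outside _ hxrr] at h2
      exact absurd (mul_left_cancel h2) hab
  have hF : F x = x * a := by
    rcases h.step x with h1 | h1
    · exact h1
    · have h2 := h.triple x h1
      rw [← hrd, hFr] at h2
      exact absurd (mul_left_cancel h2) hab
  have hU := fun {x c} => mul_mem_of_closed h.mul_right_mem (x := x) (c := c)
  obtain ⟨A, B, C, D, E⟩ := h.mul_tripleCycle hr hab hrd hF hFr (h.outside _ hxrr)
  have hMB : ∀ w ∈ M, (F * tripleCycle x r) w = w * b := fun w hw =>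
    (hMK w hw).elim (fun h1 => B w (Or.inl h1)) (E w)
  have n1 : ¬ SameCycle F (x * r) (x * r * r) :=
    fun hs => hxrr (sameCycle_mem (h.closed hab) hs hxr)
  have hc1 : ∀ w, (w ∈ U ∨ ∃ c ∈ Subgroup.zpowers a, w = x * r * r * c) →
      SameCycle (F * swap (x * r) (x * r * r)) x w := by
    have h0 : ∀ w ∈ U, SameCycle (F * swap (x * r) (x * r * r)) x w := fun w hw =>
      sameCycle_mul_swap n1 (h.conn x hx (by simp) w hw (by simp))
    rintro w (hw | ⟨c, hc, rfl⟩)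
    · exact h0 w hw
    · exact (h0 _ hxr).trans ((sameCycle_mul_swap_self n1).trans (sameCycle_mul_swap n1
        (orbit (fun c hc => h.outside _ (fun h3 => hxrr ((hU hc).1 h3))) hc)))
  have key : ∀ w, (w ∈ U ∨ ∃ c ∈ Subgroup.zpowers a, w = x * r * r * c) →
      w ∉ M → SameCycle (F * tripleCycle x r) (x * r * r) w := by
    intro w hw hwM
    -- The first transposition absorbs the new coset; the second splits the result into at most two
    -- cycles, through `x` and through `x r²`. The one through `x` stays inside `M`, so everything
    -- outside `M` lies on the other.
    rw [tripleCycle_eq hr3 hr1, ← mul_assoc]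
    refine (sameCycle_mul_swap_or (y := x * r * r) (hc1 w hw)).resolve_left fun hs => hwM ?_
    rw [mul_assoc, ← tripleCycle_eq hr3 hr1] at hs
    exact sameCycle_mem (W := M) (fun w hw => by rw [hMB w hw]; exact (hM w hw).2) hs hxM
  refine ⟨C, fun w hw => ?_, ?_, fun w hw => ?_, hMB,
    fun w hw => ⟨Or.inl (hM w hw).1, hw, (hM w hw).2⟩, ?_⟩
  · simp only [Set.mem_ofPred_eq, not_or, not_exists, not_and] at hw
    have h1 : w ≠ x := by rintro rfl; exact hw.1 hx
    have h2 : w ≠ x * r := by rintro rfl; exact hw.1 hxr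
    have h3 : w ≠ x * r * r := fun h3 => (hw.2 1 (one_mem _)) (by simpa using h3)
    rw [A w h1 h2 h3, h.outside w hw.1]
  · rintro w (hw | ⟨c, hc, rfl⟩)
    · exact Or.inl (h.mul_right_mem w hw)
    · exact Or.inr ⟨c * a, mul_mem hc (Subgroup.mem_zpowers a), by group⟩
  · rw [← hrd]; exact D w hw
  · intro w hw hwM z hz hzM
    exact (key w hw hwM).symm.trans (key z hz hzM)

end Triple

end State

/-! ### The two transitions, the three-cycles on adjacent positions, and the normalizing
permutations. -/

section Letters

/-- Right multiplication by `rot q` is the push-to-the-top transition on the last index of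
`[q + 4]`. -/
def rot (q : ℕ) : Perm (Fin (q + 4)) := (finRotate (q + 4))⁻¹

/-- Right multiplication by `push q` is the push-to-the-top transition on the index `q + 2` of
`[q + 4]`. -/
def push (q : ℕ) : Perm (Fin (q + 4)) := (Fin.cycleRange ⟨q + 1, by omega⟩)⁻¹

/-- The three-cycle `i ↦ i + 1 ↦ i + 2 ↦ i` on `Fin (q + 4)`. -/
def window (q i : ℕ) : Perm (Fin (q + 4)) :=
  swap (Fin.ofNat (q + 4) i) (Fin.ofNat (q + 4) (i + 1)) *
    swap (Fin.ofNat (q + 4) (i + 1)) (Fin.ofNat (q + 4) (i + 2))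

theorem rot_inv_apply (q : ℕ) (k : Fin (q + 4)) : (rot q)⁻¹ k = k + 1 := by
  rw [rot, inv_inv, finRotate_apply]

theorem rot_inv_ofNat (q i : ℕ) :
    (rot q)⁻¹ (Fin.ofNat (q + 4) i) = Fin.ofNat (q + 4) (i + 1) := by
  rw [rot_inv_apply]
  apply Fin.ext
  simp [Fin.val_add]

theorem val_rot (q : ℕ) (k : Fin (q + 4)) :
    (rot q k : ℕ) = if (k : ℕ) = 0 then q + 3 else (k : ℕ) - 1 := by
  obtain ⟨j, rfl⟩ : ∃ j, k = (rot q)⁻¹ j := ⟨rot q k, by simp⟩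
  rw [show rot q ((rot q)⁻¹ j) = j by simp, rot_inv_apply]
  rw [Fin.val_add_one]
  have := j.2
  split_ifs with h1 h2 h3 <;> simp_all [Fin.ext_iff]

theorem val_push (q : ℕ) (k : Fin (q + 4)) :
    (push q k : ℕ) = if (k : ℕ) = 0 then q + 1 else if (k : ℕ) ≤ q + 1 then (k : ℕ) - 1 else k := by
  obtain ⟨j, rfl⟩ : ∃ j, k = (push q)⁻¹ j := ⟨push q k, by simp⟩
  rw [show push q ((push q)⁻¹ j) = j by simp, push, inv_inv]
  have hj := j.2
  rcases lt_trichotomy (j : ℕ) (q + 1) with h | h | h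
  · rw [Fin.coe_cycleRange_of_lt (Fin.lt_def.2 h)]
    rw [if_neg (Nat.succ_ne_zero _), if_pos (by omega), Nat.add_sub_cancel]
  · rw [Fin.cycleRange_of_eq (Fin.ext h)]
    simpa using h
  · rw [Fin.cycleRange_of_gt (Fin.lt_def.2 h)]
    split_ifs <;> omega

theorem val_window (q i : ℕ) (hi : i + 2 < q + 4) (k : Fin (q + 4)) :
    (window q i k : ℕ) = if (k : ℕ) = i then i + 1 else if (k : ℕ) = i + 1 then i + 2 else
      if (k : ℕ) = i + 2 then i else k := by
  have h0 : (Fin.ofNat (q + 4) i : ℕ) = i := Nat.mod_eq_of_lt (by omega)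
  have h1 : (Fin.ofNat (q + 4) (i + 1) : ℕ) = i + 1 := Nat.mod_eq_of_lt (by omega)
  have h2 : (Fin.ofNat (q + 4) (i + 2) : ℕ) = i + 2 := Nat.mod_eq_of_lt (by omega)
  simp only [window, mul_apply, swap_apply_def, Fin.ext_iff]
  rw [h0, h1, h2]
  split_ifs <;> omega

theorem window_conj (q i : ℕ) : window q (i + 1) = (rot q)⁻¹ * window q i * rot q := by
  have h : ∀ j j', swap (Fin.ofNat (q + 4) (j + 1)) (Fin.ofNat (q + 4) (j' + 1)) =
      (rot q)⁻¹ * swap (Fin.ofNat (q + 4) j) (Fin.ofNat (q + 4) j') * rot q := fun j j' => by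
    rw [← rot_inv_ofNat, ← rot_inv_ofNat, swap_apply_apply, inv_inv]
  simp only [window]
  conv_lhs => rw [show i + 1 + 2 = i + 2 + 1 from rfl, h i (i + 1), h (i + 1) (i + 2)]
  simp only [mul_assoc, mul_inv_cancel_left]

/-- Triples act only at the window `q + 1`; rotating the word first makes that window act at any
chosen position. -/
theorem window_eq (q i e : ℕ) : window q i * rot q ^ e = rot q ^ e * window q (i + e) := by
  induction e with
  | zero => simp
  | succ e ih => rw [← add_assoc, window_conj, pow_succ, ← mul_assoc, ih]; group

/-- This identifies `r = b a⁻¹` as a three-cycle on the last three positions, so that switches come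
in triples. -/
theorem push_eq (q : ℕ) : push q * (rot q)⁻¹ = window q (q + 1) := by
  rw [mul_inv_eq_iff_eq_mul]
  ext k
  have := k.2
  rw [mul_apply, val_push, val_window _ _ (by omega), val_rot]
  split_ifs <;> omega

theorem window_pow (q i : ℕ) (hi : i + 2 < q + 4) : window q i ^ 3 = 1 := by
  ext k
  have := k.2
  simp only [pow_succ, pow_zero, one_mul, mul_apply, one_apply, val_window q i hi]
  split_ifs <;> omega

theorem sign_window (q i : ℕ) (hi : i + 2 < q + 4) : sign (window q i) = 1 := by
  have h0 : (Fin.ofNat (q + 4) i : ℕ) = i := Nat.mod_eq_of_lt (by omega)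
  have h1 : (Fin.ofNat (q + 4) (i + 1) : ℕ) = i + 1 := Nat.mod_eq_of_lt (by omega)
  have h2 : (Fin.ofNat (q + 4) (i + 2) : ℕ) = i + 2 := Nat.mod_eq_of_lt (by omega)
  rw [window, Perm.sign_mul, sign_swap (by rw [Ne, Fin.ext_iff]; omega),
    sign_swap (by rw [Ne, Fin.ext_iff]; omega)]
  rfl

theorem sign_push {q : ℕ} (hq : Odd q) : sign (push q) = 1 := by
  rw [push, sign_inv, Fin.sign_cycleRange]
  exact Even.neg_one_pow (by simpa using hq.add_one)

theorem sign_rot {q : ℕ} (hq : Odd q) : sign (rot q) = 1 := by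
  rw [rot, sign_inv, sign_finRotate]
  exact Even.neg_one_pow (by have := hq.add_one; grind)

theorem rot_ne_push (q : ℕ) : rot q ≠ push q := by
  intro h
  have h1 := val_rot q 0
  rw [h, val_push] at h1
  simp at h1

/-- The product of `ρ⁻¹`, `ρ = window q (q + 1)`, and windows that moves the letter from position
`q + 3` to position `q + 2`, and the letter from position `q + 2` to the last position. -/
def insAux (q : ℕ) : ℕ → Perm (Fin (q + 4))
  | 0 => (window q (q + 1))⁻¹ * window q q
  | d + 1 => insAux q d * window q (q - 2 * (d / 2) - 2)

/-- For `1 ≤ i ≤ q + 2`, right multiplication by `ins q i` moves the letter at the last position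
to position `i` and the letter before it to the last position. -/
def ins (q i : ℕ) : Perm (Fin (q + 4)) :=
  if i = 0 then 1 else if i ≤ q then insAux q (q - i) else
    if i = q + 1 then (window q (q + 1))⁻¹ else (window q (q + 1))⁻¹ * (window q q)⁻¹

theorem ins_chain {q : ℕ} (hq : Odd q) {i : ℕ} (hi : Odd i) (hiq : i ≤ q) :
    ins q (i + 1) = ins q (i + 2) * window q i ∧ ins q i = ins q (i + 1) * window q i := by
  have hi0 : i ≠ 0 := by rintro rfl; simp at hi
  rcases hiq.eq_or_lt with rfl | hlt
  · simp [ins, hi0, insAux]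
  · obtain ⟨a, rfl⟩ := hq
    obtain ⟨b, rfl⟩ := hi
    have h1 : 2 * b + 1 + 2 ≤ 2 * a + 1 := by omega
    have h2 : 2 * b + 1 + 1 ≤ 2 * a + 1 := by omega
    obtain ⟨c, rfl⟩ : ∃ c, a = b + 1 + c := ⟨a - b - 1, by omega⟩
    simp only [ins, if_pos hiq, if_pos h1, if_pos h2, if_neg hi0, Nat.succ_ne_zero, if_false]
    have e1 : 2 * (b + 1 + c) + 1 - (2 * b + 1 + 1) = 2 * c + 1 := by omega
    have e2 : 2 * (b + 1 + c) + 1 - (2 * b + 1 + 2) = 2 * c := by omega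
    have e3 : 2 * (b + 1 + c) + 1 - (2 * b + 1) = 2 * c + 1 + 1 := by omega
    -- The rounding `2 * (d / 2)` makes the steps `d = 2c` and `d = 2c + 1` use the same window `i =
    -- 2b + 1`, as one triple requires.
    have e4 : 2 * (b + 1 + c) + 1 - 2 * (2 * c / 2) - 2 = 2 * b + 1 := by omega
    have e5 : 2 * (b + 1 + c) + 1 - 2 * ((2 * c + 1) / 2) - 2 = 2 * b + 1 := by omega
    rw [e1, e2, e3]
    exact ⟨by rw [insAux, e4], by rw [insAux, e5]⟩

theorem window_inv_val (q i : ℕ) (hi : i + 2 < q + 4) (k : Fin (q + 4)) :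
    ((window q i)⁻¹ k : ℕ) = if (k : ℕ) = i then i + 2 else if (k : ℕ) = i + 1 then i else
      if (k : ℕ) = i + 2 then i + 1 else k := by
  obtain ⟨j, rfl⟩ : ∃ j, k = window q i j := ⟨(window q i)⁻¹ k, by simp⟩
  rw [show (window q i)⁻¹ (window q i j) = j by simp, val_window q i hi]
  split_ifs <;> omega

theorem insAux_apply (q d : ℕ) (hd : d < q) (hq : Odd q) :
    (∀ k : Fin (q + 4), (k : ℕ) = q + 3 → (insAux q d k : ℕ) = q + 2) ∧
      ∀ k : Fin (q + 4), (k : ℕ) = q - d → (insAux q d k : ℕ) = q + 3 := by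
  induction d with
  | zero =>
    constructor <;> intro k hk <;>
    · rw [insAux, mul_apply, window_inv_val _ _ (by omega), val_window _ _ (by omega)]
      split_ifs <;> omega
  | succ d ih =>
    obtain ⟨h1, h2⟩ := ih (by omega)
    have hw : q - 2 * (d / 2) - 2 + 2 < q + 4 := by omega
    obtain ⟨b, rfl⟩ := hq
    constructor <;> intro k hk <;> rw [insAux, mul_apply]
    · apply h1
      rw [val_window _ _ hw]
      split_ifs <;> omega
    · apply h2
      rw [val_window _ _ hw]
      split_ifs <;> omega

/-- `ins q i` puts the first special letter last and the second one to position `i`. -/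
theorem ins_apply {q : ℕ} (hq : Odd q) {i : ℕ} (hi : 1 ≤ i) (hiq : i ≤ q + 2) :
    (∀ k : Fin (q + 4), (k : ℕ) = q + 3 → (ins q i k : ℕ) = q + 2) ∧
      ∀ k : Fin (q + 4), (k : ℕ) = i → (ins q i k : ℕ) = q + 3 := by
  rw [ins, if_neg (by omega)]
  split_ifs with h1 h2
  · have := insAux_apply q (q - i) (by omega) hq
    rwa [Nat.sub_sub_self h1] at this
  · constructor <;> intro k hk <;>
    · rw [window_inv_val _ _ (by omega)]
      split_ifs <;> omega
  · constructor <;> intro k hk <;>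
    · rw [mul_apply, window_inv_val _ _ (by omega), window_inv_val _ _ (by omega)]
      split_ifs <;> omega

theorem sign_ins {q : ℕ} (i : ℕ) : sign (ins q i) = 1 := by
  have h : ∀ d, sign (insAux q d) = 1 := by
    intro d
    induction d with
    | zero => rw [insAux, Perm.sign_mul, sign_inv, sign_window _ _ (by omega),
        sign_window _ _ (by omega), one_mul]
    | succ d ih => rw [insAux, Perm.sign_mul, ih, sign_window _ _ (by omega), one_mul]
  rw [ins]
  split_ifs
  · exact sign_one
  · exact h _
  · rw [sign_inv, sign_window _ _ (by omega)]
  · rw [Perm.sign_mul, sign_inv, sign_inv, sign_window _ _ (by omega), sign_window _ _ (by omega),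
      one_mul]

/-- The relation behind merging `(y, q)` with `(y * push q, q + 1)`. -/
theorem ins_link (q : ℕ) (hq : Odd q) :
    ins q q * window q (q + 1) * rot q = push q * ins q (q + 1) := by
  have hq0 : q ≠ 0 := by rintro rfl; simp at hq
  have h1 : ins q q = (window q (q + 1))⁻¹ * window q q := by simp [ins, hq0, insAux]
  have h2 : ins q (q + 1) = (window q (q + 1))⁻¹ := by simp [ins]
  rw [h1, h2]
  ext k
  simp only [mul_apply]
  have hk := k.2
  have a1 := val_rot q k
  have a2 := val_window q (q + 1) (by omega) (rot q k)
  have a3 := val_window q q (by omega) (window q (q + 1) (rot q k))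
  have a4 := window_inv_val q (q + 1) (by omega) (window q q (window q (q + 1) (rot q k)))
  have b1 := window_inv_val q (q + 1) (by omega) k
  have b2 := val_push q ((window q (q + 1))⁻¹ k)
  have hc : (k : ℕ) = 0 ∨ (1 ≤ (k : ℕ) ∧ (k : ℕ) < q) ∨ (k : ℕ) = q ∨ (k : ℕ) = q + 1 ∨
    (k : ℕ) = q + 2 ∨ (k : ℕ) = q + 3 := by omega
  rcases hc with h | h | h | h | h | h <;>
  · split_ifs at a1 <;> try omega
    split_ifs at a2 <;> try omega
    split_ifs at a3 <;> try omega
    split_ifs at a4 <;> try omega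
    split_ifs at b1 <;> try omega
    split_ifs at b2 <;> omega

/-- Two disjoint adjacent transpositions next to each other in cyclic order (for `q ≥ 2`). -/
def doubleSwap (q : ℕ) : Perm (Fin (q + 4)) :=
  swap ⟨0, by omega⟩ ⟨1, by omega⟩ * swap ⟨q, by omega⟩ ⟨q + 1, by omega⟩

/-- The values on both sides of `ins_link'`, computed one factor at a time. -/
theorem link_arith (q k x1 x2 x3 x4 x5 y1 y2 y3 y4 y5 : ℕ) (hq : 2 ≤ q) (hk : k < q + 4)
  (a1 : x1 = if k = 0 then q + 3 else k - 1)
  (a2 : x2 = if x1 = 0 then q + 3 else x1 - 1)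
  (a3 : x3 = if x2 = q + 1 then q + 1 + 1 else if x2 = q + 1 + 1 then q + 1 + 2
    else if x2 = q + 1 + 2 then q + 1 else x2)
  (a4 : x4 = if x3 = q + 3 then 0 else x3 + 1)
  (a5 : x5 = if x4 = q + 1 then q + 1 + 2 else if x4 = q + 1 + 1 then q + 1
    else if x4 = q + 1 + 2 then q + 1 + 1 else x4)
  (b1 : y1 = if k = q then q + 2 else if k = q + 1 then q else if k = q + 2 then q + 1 else k)
  (b2 : y2 = if y1 = q + 1 then q + 1 + 2 else if y1 = q + 1 + 1 then q + 1
    else if y1 = q + 1 + 2 then q + 1 + 1 else y1)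
  (b3 : y3 = if y2 = q then q + 1 else if y2 = q + 1 then q else y2)
  (b4 : y4 = if y3 = 0 then 1 else if y3 = 1 then 0 else y3)
  (b5 : y5 = if y4 = 0 then q + 1 else if y4 ≤ q + 1 then y4 - 1 else y4) : x5 = y5 := by
  have hc : k = 0 ∨ k = 1 ∨ (2 ≤ k ∧ k < q) ∨ k = q ∨ k = q + 1 ∨ k = q + 2 ∨ k = q + 3 := by omega
  rcases hc with h | h | h | h | h | h | h
  all_goals split_ifs at a1 <;> try omega
  all_goals split_ifs at a2 <;> try omega
  all_goals split_ifs at a3 <;> try omega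
  all_goals split_ifs at a4 <;> try omega
  all_goals split_ifs at a5 <;> try omega
  all_goals split_ifs at b1 <;> try omega
  all_goals split_ifs at b2 <;> try omega
  all_goals split_ifs at b3 <;> try omega
  all_goals split_ifs at b4 <;> try omega
  all_goals split_ifs at b5 <;> try omega

/-- The relation behind merging `(y, q)` with `(y * push q ^ 2 * doubleSwap q, q + 2)`. -/
theorem ins_link' (q : ℕ) (hq : Odd q) :
    ins q q * window q (q + 1) * window q (q + 1) * rot q ^ 2 =
      push q ^ 2 * doubleSwap q * ins q (q + 2) := by
  have hq0 : q ≠ 0 := by rintro rfl; simp at hq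
  have h1 : ins q q = (window q (q + 1))⁻¹ * window q q := by simp [ins, hq0, insAux]
  have h2 : ins q (q + 2) = (window q (q + 1))⁻¹ * (window q q)⁻¹ := by simp [ins]
  have h3 : ins q q * window q (q + 1) = push q * (window q (q + 1))⁻¹ * (rot q)⁻¹ := by
    have h := ins_link q hq
    rw [show ins q (q + 1) = (window q (q + 1))⁻¹ by simp [ins]] at h
    rw [← h, mul_inv_cancel_right]
  rw [h3, h2, doubleSwap, pow_two, pow_two]
  suffices h : (window q (q + 1))⁻¹ * (rot q)⁻¹ * window q (q + 1) * (rot q * rot q) =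
      push q * (swap ⟨0, by omega⟩ ⟨1, by omega⟩ * swap ⟨q, by omega⟩ ⟨q + 1, by omega⟩) *
        ((window q (q + 1))⁻¹ * (window q q)⁻¹) by
    simpa only [mul_assoc] using congrArg (push q * ·) h
  clear h1 h2 h3
  -- The case split in `link_arith` assumes `2 ≤ q`; the remaining case is a finite check on five
  -- letters.
  rcases eq_or_ne q 1 with rfl | hq1
  · decide
  have hq2 : 2 ≤ q := by omega
  have hs : ∀ k : Fin (q + 4), ((swap ⟨q, by omega⟩ ⟨q + 1, by omega⟩ : Perm (Fin (q + 4))) k : ℕ) =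
      if (k : ℕ) = q then q + 1 else if (k : ℕ) = q + 1 then q else k := fun k => by
    rw [swap_apply_def]; simp only [Fin.ext_iff]; split_ifs <;> rfl
  have hs' : ∀ k : Fin (q + 4), ((swap ⟨0, by omega⟩ ⟨1, by omega⟩ : Perm (Fin (q + 4))) k : ℕ) =
      if (k : ℕ) = 0 then 1 else if (k : ℕ) = 1 then 0 else (k : ℕ) := fun k => by
    rw [swap_apply_def]; simp only [Fin.ext_iff]; split_ifs <;> rfl
  ext k
  simp only [mul_apply]
  have hk := k.2
  have hinv : ∀ k : Fin (q + 4), ((rot q)⁻¹ k : ℕ) = if (k : ℕ) = q + 3 then 0 else (k : ℕ) + 1 := by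
    intro k
    have := val_rot q ((rot q)⁻¹ k)
    rw [show rot q ((rot q)⁻¹ k) = k by simp] at this
    split_ifs at this ⊢ <;> omega
  exact link_arith q k _ _ _ _ _ _ _ _ _ _ hq2 hk (val_rot q k) (val_rot q (rot q k))
    (val_window q (q + 1) (by omega) (rot q (rot q k))) (hinv _)
    (window_inv_val q (q + 1) (by omega) _) (window_inv_val q q (by omega) k)
    (window_inv_val q (q + 1) (by omega) _) (hs _) (hs' _) (val_push q _)

end Letters

/-! ### Labelling the cosets of `⟨rot q⟩` in one parity class. -/

section Necklaces

variable {q : ℕ}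

theorem orderOf_push (q : ℕ) : orderOf (push q) = q + 2 := by
  rw [push, orderOf_inv, ← lcm_cycleType, Fin.cycleType_cycleRange]
  · simp
  · simp [Fin.ext_iff]

theorem push_pow_inj {s t : ℕ} (hs : s < q + 2) (ht : t < q + 2) (z : Perm (Fin (q + 4))) :
    z * push q ^ s = z * push q ^ t ↔ s = t := by
  refine ⟨fun h => ?_, fun h => by rw [h]⟩
  have := orderOf_push q
  exact pow_injOn_Iio_orderOf (by simpa [this]) (by simpa [this]) (mul_left_cancel h)

theorem push_pow_eq_one : push q ^ (q + 2) = 1 := by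
  have h := pow_orderOf_eq_one (push q)
  rwa [orderOf_push] at h

/-- The permutations with the sign of `u` and the same last two entries. -/
def sameEnd (u : Perm (Fin (q + 4))) : Set (Perm (Fin (q + 4))) :=
  {y | sign y = sign u ∧ ∀ k : Fin (q + 4), q + 2 ≤ (k : ℕ) → y k = u k}

theorem sameEnd_mul {u y g : Perm (Fin (q + 4))} (hy : y ∈ sameEnd u) (hs : sign g = 1)
    (hg : ∀ k : Fin (q + 4), q + 2 ≤ (k : ℕ) → g k = k) : y * g ∈ sameEnd u :=
  ⟨by rw [Perm.sign_mul, hs, mul_one, hy.1], fun k hk => by rw [mul_apply, hg k hk, hy.2 k hk]⟩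

theorem push_apply_of_le {k : Fin (q + 4)} (hk : q + 2 ≤ (k : ℕ)) : push q k = k := by
  apply Fin.ext
  rw [val_push, if_neg (by omega), if_neg (by omega)]

theorem sameEnd_mul_push (hq : Odd q) {u y : Perm (Fin (q + 4))} (hy : y ∈ sameEnd u) (t : ℕ) :
    y * push q ^ t ∈ sameEnd u := by
  induction t with
  | zero => simpa using hy
  | succ t ih =>
    rw [pow_succ, ← mul_assoc]
    exact sameEnd_mul ih (sign_push hq) (fun k hk => push_apply_of_le hk)

/-- The orbit of right multiplication by `rot q` with the label `p`. -/
def necklace (p : Perm (Fin (q + 4)) × ℕ) : Set (Perm (Fin (q + 4))) :=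
  {x | ∃ c ∈ Subgroup.zpowers (rot q), x = p.1 * ins q p.2 * c}

theorem zpowers_rot_apply {c : Perm (Fin (q + 4))} (hc : c ∈ Subgroup.zpowers (rot q)) :
    ∃ t, ∀ k, c k = k + t := by
  rw [← Subgroup.zpowers_inv] at hc
  obtain ⟨i, rfl⟩ := (mem_powers_iff_mem_zpowers).2 hc
  induction i with
  | zero => exact ⟨0, by simp⟩
  | succ i ih =>
    obtain ⟨t, ht⟩ := ih (Subgroup.npow_mem_zpowers _ _)
    exact ⟨t + 1, fun k => by simp only [pow_succ', mul_apply, ht, rot_inv_apply, add_assoc] at ht ⊢⟩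

theorem exists_zpowers_rot (t : Fin (q + 4)) :
    ∃ c ∈ Subgroup.zpowers (rot q), ∀ k, c k = k + t := by
  refine ⟨(rot q)⁻¹ ^ (t : ℕ), pow_mem (inv_mem (Subgroup.mem_zpowers _)) _, ?_⟩
  have h : ∀ (n : ℕ) (k : Fin (q + 4)), ((rot q)⁻¹ ^ n) k = k + Fin.ofNat (q + 4) n := by
    intro n
    induction n with
    | zero => intro k; simp
    | succ n ih =>
      intro k
      rw [pow_succ', mul_apply, ih, rot_inv_apply, add_assoc]
      congr 1
      apply Fin.ext
      simp [Fin.val_add]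
  intro k
  rw [h]
  simp

/-- The cyclic distance from the first special letter to the second is `i + 1`. The first letter
sits at `q + 2` when `i = 0`, where `ins q 0 = 1`, and at the last position otherwise. -/
theorem ins_position (hq : Odd q) {i : ℕ} (hi : i ≤ q + 2) :
    ∃ P : Fin (q + 4), ins q i P = ⟨q + 2, by omega⟩ ∧
      ins q i (P + Fin.ofNat (q + 4) (i + 1)) = ⟨q + 3, by omega⟩ := by
  rcases Nat.eq_zero_or_pos i with rfl | hi0
  · refine ⟨⟨q + 2, by omega⟩, by simp [ins], ?_⟩
    rw [ins, if_pos rfl, one_apply]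
    apply Fin.ext
    simp only [Fin.val_add, Fin.ofNat]
    rw [Nat.mod_eq_of_lt (a := 0 + 1) (by omega), Nat.mod_eq_of_lt (by omega)]
  · obtain ⟨h1, h2⟩ := ins_apply hq hi0 hi
    refine ⟨⟨q + 3, by omega⟩, Fin.ext (h1 _ rfl), Fin.ext (h2 _ ?_)⟩
    simp only [Fin.val_add, Fin.ofNat]
    rw [Nat.add_mod_mod, show q + 3 + (i + 1) = i + (q + 4) by omega, Nat.add_mod_right,
      Nat.mod_eq_of_lt (by omega)]

/-- The distance between the special letters is invariant under rotation and determines `i`; then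
the position of the first special letter determines the rotation, and cancelling leaves `y`. -/
theorem necklace_inj (hq : Odd q) {u y y' x : Perm (Fin (q + 4))} {i i' : ℕ}
    (hy : y ∈ sameEnd u) (hy' : y' ∈ sameEnd u) (hi : i ≤ q + 2) (hi' : i' ≤ q + 2)
    (hx : x ∈ necklace (y, i)) (hx' : x ∈ necklace (y', i')) : y = y' ∧ i = i' := by
  have key : ∀ {y i}, y ∈ sameEnd u → i ≤ q + 2 → x ∈ necklace (y, i) →
      x⁻¹ (u ⟨q + 3, by omega⟩) = x⁻¹ (u ⟨q + 2, by omega⟩) + Fin.ofNat (q + 4) (i + 1) := by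
    rintro y i hy hi ⟨c, hc, rfl⟩
    obtain ⟨t, ht⟩ := zpowers_rot_apply hc
    obtain ⟨P, hP, hP'⟩ := ins_position hq hi
    have hs : (y * ins q i * c)⁻¹ (u ⟨q + 2, by omega⟩) = P - t := by
      rw [inv_eq_iff_eq]
      simp only [mul_apply, ht, sub_add_cancel, hP]
      exact (hy.2 _ le_rfl).symm
    rw [hs, inv_eq_iff_eq]
    simp only [mul_apply, ht]
    rw [show P - t + Fin.ofNat (q + 4) (i + 1) + t = P + Fin.ofNat (q + 4) (i + 1) by abel, hP']
    exact (hy.2 _ (Nat.le_succ _)).symm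
  have h := (key hy hi hx).symm.trans (key hy' hi' hx')
  have hii : i = i' := by
    have := congrArg Fin.val (add_left_cancel h)
    simp only [Fin.ofNat] at this
    rw [Nat.mod_eq_of_lt (by omega), Nat.mod_eq_of_lt (by omega)] at this
    omega
  subst hii
  refine ⟨?_, rfl⟩
  obtain ⟨c, hc, hx⟩ := hx
  obtain ⟨c', hc', hx'⟩ := hx'
  obtain ⟨t, ht⟩ := zpowers_rot_apply hc
  obtain ⟨t', ht'⟩ := zpowers_rot_apply hc'
  obtain ⟨P, hP, -⟩ := ins_position hq hi
  have hs : ∀ {y c t}, y ∈ sameEnd u → (∀ k, c k = k + t) → x = y * ins q i * c →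
      x (P - t) = u ⟨q + 2, by omega⟩ := by
    rintro y c t hy ht rfl
    simp only [mul_apply, ht, sub_add_cancel, hP]
    exact hy.2 _ le_rfl
  have h1 := (hs hy ht hx).trans (hs hy' ht' hx').symm
  have h2 : t = t' := sub_right_injective (x.injective h1)
  have h3 : c = c' := by ext k; rw [ht, ht', h2]
  rw [hx, h3] at hx'
  exact mul_right_cancel (mul_right_cancel hx')

/-- Read `i` off the distance between the special letters, rotate `x` into standard position and
undo `ins q i`. All factors are even, so the sign of `u` is kept. -/
theorem exists_necklace (hq : Odd q) {u x : Perm (Fin (q + 4))} (hx : sign x = sign u) :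
    ∃ y ∈ sameEnd u, ∃ i ≤ q + 2, x ∈ necklace (y, i) := by
  set p := x⁻¹ (u ⟨q + 2, by omega⟩) with hp
  set r := x⁻¹ (u ⟨q + 3, by omega⟩) with hr
  have hne : r - p ≠ 0 := by
    rw [sub_ne_zero, hr, hp]
    intro h
    have := u.injective ((x⁻¹).injective h)
    simp at this
  have hpos : 0 < ((r - p : Fin (q + 4)) : ℕ) := Fin.pos_iff_ne_zero.2 hne
  have hlt := (r - p).2
  obtain ⟨i, hi⟩ : ∃ i, ((r - p : Fin (q + 4)) : ℕ) = i + 1 := ⟨_, (Nat.succ_pred hpos.ne').symm⟩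
  have hiq : i ≤ q + 2 := by omega
  have hd : Fin.ofNat (q + 4) (i + 1) = r - p := by
    rw [← hi]; simp
  obtain ⟨P, hP, hP'⟩ := ins_position hq hiq
  obtain ⟨c, hc, hct⟩ := exists_zpowers_rot (P - p)
  refine ⟨x * c⁻¹ * (ins q i)⁻¹, ⟨?_, fun k hk => ?_⟩, i, hiq, c, hc, by simp⟩
  · have h1 : sign c = 1 := by
      obtain ⟨n, rfl⟩ := hc
      simp [sign_rot hq]
    simp [Perm.sign_mul, sign_ins, h1, hx]
  · have h1 : c⁻¹ P = p := by rw [inv_eq_iff_eq, hct]; abel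
    have h2 : c⁻¹ (P + Fin.ofNat (q + 4) (i + 1)) = r := by
      rw [inv_eq_iff_eq, hct, hd]; abel
    rcases (show (k : ℕ) = q + 2 ∨ (k : ℕ) = q + 3 by omega) with h | h
    · have h3 : (ins q i)⁻¹ k = P := by rw [inv_eq_iff_eq, hP]; exact Fin.ext h
      rw [mul_apply, mul_apply, h3, h1, hp, show k = ⟨q + 2, h ▸ k.2⟩ from Fin.ext h]
      simp
    · have h3 : (ins q i)⁻¹ k = P + Fin.ofNat (q + 4) (i + 1) := by
        rw [inv_eq_iff_eq, hP']; exact Fin.ext h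
      rw [mul_apply, mul_apply, h3, h2, hr, show k = ⟨q + 3, h ▸ k.2⟩ from Fin.ext h]
      simp

end Necklaces

/-! ### Growing a partial cycle label by label. -/

section Growth

variable {q : ℕ} {u : Perm (Fin (q + 4))}

/-- The label `p` is valid. -/
def ValidLabel (u : Perm (Fin (q + 4))) (p : Perm (Fin (q + 4)) × ℕ) : Prop :=
  p.1 ∈ sameEnd u ∧ p.2 ≤ q + 2

/-- The labels in `L` are valid, and there is a partial cycle on the union of their necklaces. -/
def Built (u : Perm (Fin (q + 4))) (M K : Set (Perm (Fin (q + 4))))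
    (L : Set (Perm (Fin (q + 4)) × ℕ)) : Prop :=
  (∀ p ∈ L, ValidLabel u p) ∧
    ∃ F, PartialCycle (rot q) (push q) F {x | ∃ p ∈ L, x ∈ necklace p} M K

variable {M K : Set (Perm (Fin (q + 4)))} {L : Set (Perm (Fin (q + 4)) × ℕ)}
  {p p' p'' : Perm (Fin (q + 4)) × ℕ}

theorem mul_mem_necklace {x c : Perm (Fin (q + 4))} (hx : x ∈ necklace p)
    (hc : c ∈ Subgroup.zpowers (rot q)) : x * c ∈ necklace p := by
  obtain ⟨d, hd, rfl⟩ := hx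
  exact ⟨d * c, mul_mem hd hc, by group⟩

theorem mem_necklace_iff {x z : Perm (Fin (q + 4))} (hx : x ∈ necklace p) :
    z ∈ necklace p ↔ ∃ c ∈ Subgroup.zpowers (rot q), z = x * c := by
  refine ⟨fun hz => ?_, ?_⟩
  · obtain ⟨d, hd, rfl⟩ := hx
    obtain ⟨c, hc, rfl⟩ := hz
    exact ⟨d⁻¹ * c, mul_mem (inv_mem hd) hc, by group⟩
  · rintro ⟨c, hc, rfl⟩
    exact mul_mem_necklace hx hc

theorem Built.mono (h : Built u M K L) {K' : Set (Perm (Fin (q + 4)))} (hK : K' ⊆ K)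
    (hM : M ⊆ K') : Built u M K' L :=
  ⟨h.1, h.2.choose, h.2.choose_spec.mono hK hM⟩

theorem Built.subset (h : Built u M K L) : M ⊆ K := fun x hx =>
  (h.2.choose_spec.missing x hx).2.1

theorem Built.notMem (hq : Odd q) (h : Built u M K L) (hp : ValidLabel u p) (hpL : p ∉ L)
    {x : Perm (Fin (q + 4))} (hx : x ∈ necklace p) :
    x ∉ {x | ∃ p ∈ L, x ∈ necklace p} := by
  rintro ⟨r, hr, hxr⟩
  obtain ⟨h1, h2⟩ := necklace_inj hq hp.1 (h.1 r hr).1 hp.2 (h.1 r hr).2 hx hxr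
  exact hpL (by rwa [show p = r from Prod.ext h1 h2])

/-- The translation of `PartialCycle.grow` to labels: by `necklace_inj`, distinct labels give
disjoint necklaces. The switched triple is recorded in `K`, which the construction of the missing
coset needs. -/
theorem Built.grow_aux (hq : Odd q) (h : Built u M K L) {x : Perm (Fin (q + 4))}
    (hx : x ∈ necklace p) (hx' : x * window q (q + 1) ∈ necklace p')
    (hx'' : x * window q (q + 1) * window q (q + 1) ∈ necklace p'') (hp : p ∈ L)
    (hp' : p' ∉ L) (hp'' : p'' ∉ L) (hne : p' ≠ p'') (hv' : ValidLabel u p')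
    (hv'' : ValidLabel u p'') :
    Built u M (K ∪ {x, x * window q (q + 1), x * window q (q + 1) * window q (q + 1)})
      (L ∪ {p', p''}) := by
  obtain ⟨F, hF⟩ := h.2
  have hr : (push q * (rot q)⁻¹) ^ 3 = 1 := by rw [push_eq, window_pow _ _ (by omega)]
  have hG := hF.grow hr (rot_ne_push q) (push_eq q).symm (x := x) ⟨p, hp, hx⟩
    (h.notMem hq hv' hp' hx') (h.notMem hq hv'' hp'' hx'') (by
      intro c hc heq
      rw [heq] at hx''
      obtain ⟨h1, h2⟩ := necklace_inj hq hv'.1 hv''.1 hv'.2 hv''.2 (mul_mem_necklace hx' hc) hx''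
      exact hne (Prod.ext h1 h2))
  refine ⟨?_, F * tripleCycle x (window q (q + 1)), ?_⟩
  · rintro r (hr | rfl | rfl)
    · exact h.1 r hr
    · exact hv'
    · exact hv''
  · convert hG using 1
    ext w
    constructor
    · rintro ⟨r, hr | rfl | rfl, hw⟩
      · exact Or.inl ⟨r, hr, hw⟩
      · obtain ⟨c, hc, hwc⟩ := (mem_necklace_iff hx').1 hw
        exact Or.inr ⟨c, hc, Or.inl hwc⟩
      · obtain ⟨c, hc, hwc⟩ := (mem_necklace_iff hx'').1 hw
        exact Or.inr ⟨c, hc, Or.inr hwc⟩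
    · rintro (⟨r, hr, hw⟩ | ⟨c, hc, rfl | rfl⟩)
      · exact ⟨r, Or.inl hr, hw⟩
      · exact ⟨p', Or.inr (Or.inl rfl), mul_mem_necklace hx' hc⟩
      · exact ⟨p'', Or.inr (Or.inr rfl), mul_mem_necklace hx'' hc⟩

/-- Three necklaces that can be merged at a triple `x, x ρ, x ρ²`. -/
def Mergeable (p p' p'' : Perm (Fin (q + 4)) × ℕ) : Prop :=
  ∃ x, x ∈ necklace p ∧ x * window q (q + 1) ∈ necklace p' ∧
    x * window q (q + 1) * window q (q + 1) ∈ necklace p''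

/-- As `r³ = 1`, any of the three necklaces may play the role of the one already present. -/
theorem Mergeable.rotate (h : Mergeable p p' p'') : Mergeable p' p'' p := by
  obtain ⟨x, h1, h2, h3⟩ := h
  refine ⟨_, h2, h3, ?_⟩
  rwa [triple_pow (window_pow _ _ (by omega))]

theorem Built.grow (hq : Odd q) (h : Built u M K L) (ht : Mergeable p p' p'') (hp : p ∈ L)
    (hp' : p' ∉ L) (hp'' : p'' ∉ L) (hne : p' ≠ p'') (hv' : ValidLabel u p')
    (hv'' : ValidLabel u p'') : Built u M K (L ∪ {p', p''}) := by
  obtain ⟨x, h1, h2, h3⟩ := ht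
  exact (h.grow_aux hq h1 h2 h3 hp hp' hp'' hne hv' hv'').mono Set.subset_union_left h.subset

theorem self_mem_necklace (y : Perm (Fin (q + 4))) (i : ℕ) : y * ins q i ∈ necklace (y, i) :=
  ⟨1, one_mem _, by simp⟩

/-- By `ins_chain` the three normal forms differ by the window `i`, and `q + 1 - i` rotations turn
it into the window `q + 1` of a triple. -/
theorem mergeable_chain (hq : Odd q) (y : Perm (Fin (q + 4))) {i : ℕ} (hi : Odd i) (hiq : i ≤ q) :
    Mergeable (y, i + 2) (y, i + 1) (y, i) := by
  obtain ⟨h1, h2⟩ := ins_chain hq hi hiq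
  have he := window_eq q i (q + 1 - i)
  rw [show i + (q + 1 - i) = q + 1 by omega] at he
  have hm : rot q ^ (q + 1 - i) ∈ Subgroup.zpowers (rot q) := Subgroup.npow_mem_zpowers _ _
  refine ⟨y * ins q (i + 2) * rot q ^ (q + 1 - i), mul_mem_necklace (self_mem_necklace _ _) hm,
    ?_, ?_⟩
  · rw [mul_assoc, ← he, ← mul_assoc, mul_assoc y, ← h1]
    exact mul_mem_necklace (self_mem_necklace _ _) hm
  · rw [mul_assoc (y * _), ← he, ← mul_assoc, mul_assoc y, ← h1, mul_assoc, ← he, ← mul_assoc,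
      mul_assoc y, ← h2]
    exact mul_mem_necklace (self_mem_necklace _ _) hm

/-- Here `r = push q * (rot q)⁻¹` is `push q` up to rotation, and `r² = r⁻¹ = ins q (q + 1)`. These
triples step along a coset of `⟨push q⟩` and enter the column of `y` on the way. -/
theorem ring_mem (y : Perm (Fin (q + 4))) :
    y ∈ necklace (y, 0) ∧ y * window q (q + 1) ∈ necklace (y * push q, 0) ∧
      y * window q (q + 1) * window q (q + 1) ∈ necklace (y, q + 1) := by
  refine ⟨⟨1, one_mem _, by simp [ins]⟩,
    ⟨(rot q)⁻¹, inv_mem (Subgroup.mem_zpowers _), by rw [← push_eq]; simp [ins, mul_assoc]⟩,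
    ⟨1, one_mem _, ?_⟩⟩
  have h := window_pow q (q + 1) (by omega)
  rw [pow_succ, pow_two] at h
  rw [mul_assoc, eq_inv_of_mul_eq_one_left h]
  simp [ins]

/-- The only triples used to pass between cosets of `⟨push q⟩`. The exponents are chosen so that
`push q ^ (q + 2) = 1` cancels in the third label. -/
theorem mergeable_link (hq : Odd q) (z : Perm (Fin (q + 4))) :
    Mergeable (z * push q ^ q, q) (z * push q ^ (q + 1), q + 1) (z * doubleSwap q, q + 2) := by
  refine ⟨_, self_mem_necklace _ _, ⟨(rot q)⁻¹, inv_mem (Subgroup.mem_zpowers _), ?_⟩,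
    ⟨(rot q)⁻¹ ^ 2, pow_mem (inv_mem (Subgroup.mem_zpowers _)) _, ?_⟩⟩
  · rw [eq_mul_inv_iff_mul_eq]
    simp only [mul_assoc, pow_succ]
    rw [← ins_link q hq]
    simp only [mul_assoc]
  · rw [inv_pow, eq_mul_inv_iff_mul_eq]
    have h : z * doubleSwap q = z * push q ^ q * (push q ^ 2 * doubleSwap q) := by
      rw [mul_assoc z, ← mul_assoc (push q ^ q), ← pow_add, push_pow_eq_one, one_mul]
    simp only
    rw [h, mul_assoc (z * push q ^ q) (_ * _), ← ins_link' q hq]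
    simp only [mul_assoc]

/-- The labels of the necklaces obtained by moving the special letters of `y` apart. -/
def columnLabels (y : Perm (Fin (q + 4))) : Set (Perm (Fin (q + 4)) × ℕ) :=
  {p | p.1 = y ∧ 1 ≤ p.2 ∧ p.2 ≤ q + 2}

/-- From an odd label present in the column, each triple adds the next two labels below it, down to
`1`. -/
theorem Built.chain (hq : Odd q) {y : Perm (Fin (q + 4))} (hy : y ∈ sameEnd u) (j : ℕ) :
    ∀ L, Built u M K L → 2 * j + 1 ≤ q + 2 → (y, 2 * j + 1) ∈ L →
      (∀ i, 1 ≤ i → i < 2 * j + 1 → (y, i) ∉ L) →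
      Built u M K (L ∪ {p | p.1 = y ∧ 1 ≤ p.2 ∧ p.2 < 2 * j + 1}) := by
  induction j with
  | zero =>
    intro L h _ _ _
    convert h using 1
    ext p
    simp only [Set.mem_union, Set.mem_ofPred_eq]
    constructor
    · rintro (h | ⟨-, h1, h2⟩)
      · exact h
      · omega
    · exact Or.inl
  | succ j ih =>
    intro L h hj hjL hL
    have h1 := h.grow hq (mergeable_chain hq y (i := 2 * j + 1) ⟨j, rfl⟩ (by omega)) hjL
      (hL _ (by omega) (by omega)) (hL _ (by omega) (by omega)) (by simp)
      ⟨hy, by simp only; omega⟩ ⟨hy, by simp only; omega⟩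
    have h2 := ih _ h1 (by omega) (by simp) (fun i hi hij => by
      simp only [Set.mem_union, Set.mem_insert_iff, Set.mem_singleton_iff, Prod.mk.injEq, not_or]
      refine ⟨hL i hi (by omega), by omega, by omega⟩)
    convert h2 using 1
    ext ⟨a, i⟩
    simp only [Set.mem_union, Set.mem_insert_iff, Set.mem_singleton_iff, Prod.mk.injEq,
      Set.mem_ofPred_eq]
    constructor
    · rintro (h | ⟨rfl, h1, h2⟩)
      · exact Or.inl (Or.inl h)
      · rcases (show i < 2 * j + 1 ∨ i = 2 * j + 1 ∨ i = 2 * j + 1 + 1 by omega) with h | h | h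
        · exact Or.inr ⟨rfl, h1, h⟩
        · exact Or.inl (Or.inr (Or.inr ⟨rfl, h⟩))
        · exact Or.inl (Or.inr (Or.inl ⟨rfl, h⟩))
    · rintro ((h | ⟨rfl, h⟩ | ⟨rfl, h⟩) | ⟨rfl, h1, h2⟩)
      · exact Or.inl h
      · exact Or.inr ⟨rfl, by omega, by omega⟩
      · exact Or.inr ⟨rfl, by omega, by omega⟩
      · exact Or.inr ⟨rfl, h1, by omega⟩

/-- A column can be added as soon as one of the two labels `q`, `q + 1` in it is there. -/
theorem Built.column (hq : Odd q) {y : Perm (Fin (q + 4))} (hy : y ∈ sameEnd u)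
    (h : Built u M K L) {j : ℕ} (hj : j = q ∨ j = q + 1) (hjL : (y, j) ∈ L)
    (hL : ∀ i, 1 ≤ i → i ≤ q + 2 → i ≠ j → (y, i) ∉ L) : Built u M K (L ∪ columnLabels y) := by
  obtain ⟨b, rfl⟩ := hq
  have hq : Odd (2 * b + 1) := ⟨b, rfl⟩
  -- The top triple, with labels `q`, `q + 1`, `q + 2`, is rotated so that the label already present
  -- comes first; `Built.chain` then descends from `q`.
  have ht := mergeable_chain hq y hq le_rfl
  have h1 : Built u M K
      (L ∪ {(y, 2 * b + 1), (y, 2 * b + 1 + 1), (y, 2 * b + 1 + 2)}) := by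
    rcases hj with rfl | rfl
    · have := h.grow hq ht.rotate.rotate hjL (hL _ (by omega) (by omega) (by omega))
        (hL _ (by omega) (by omega) (by omega)) (by simp)
        ⟨hy, by simp only; omega⟩ ⟨hy, by simp only; omega⟩
      convert this using 1
      ext p
      simp only [Set.mem_union, Set.mem_insert_iff, Set.mem_singleton_iff]
      by_cases hp : p = (y, 2 * b + 1)
      · subst hp; simp [hjL]
      · tauto
    · have := h.grow hq ht.rotate hjL (hL _ (by omega) (by omega) (by omega))
        (hL _ (by omega) (by omega) (by omega)) (by simp)
        ⟨hy, by simp only; omega⟩ ⟨hy, by simp only; omega⟩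
      convert this using 1
      ext p
      simp only [Set.mem_union, Set.mem_insert_iff, Set.mem_singleton_iff]
      by_cases hp : p = (y, 2 * b + 1 + 1)
      · subst hp; simp [hjL]
      · tauto
  have h2 := Built.chain hq hy b _ h1 (by omega) (by simp) (fun i hi hij => by
    simp only [Set.mem_union, Set.mem_insert_iff, Set.mem_singleton_iff, Prod.mk.injEq, not_or]
    refine ⟨hL i hi (by omega) (by omega), by omega, by omega, by omega⟩)
  convert h2 using 1
  ext ⟨a, i⟩
  simp only [Set.mem_union, Set.mem_insert_iff, Set.mem_singleton_iff, Prod.mk.injEq,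
    Set.mem_ofPred_eq, columnLabels]
  by_cases ha : a = y
  · subst ha
    simp only [true_and]
    constructor
    · rintro (h | h)
      · exact Or.inl (Or.inl h)
      · by_cases hi : i < 2 * b + 1
        · exact Or.inr ⟨h.1, hi⟩
        · exact Or.inl (Or.inr (by omega))
    · rintro ((h | h) | h)
      · exact Or.inl h
      · exact Or.inr (by omega)
      · exact Or.inr (by omega)
  · simp [ha]

/-- Adding the necklaces of consecutive elements of a coset of `⟨push q⟩` and their columns. -/
theorem Built.ring (hq : Odd q) {y : Perm (Fin (q + 4))} (hy : y ∈ sameEnd u)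
    (h : Built u M K L) (hyL : (y, 0) ∈ L) {j : ℕ} (hj : j ≤ q + 1)
    (hL : ∀ t < j, (y * push q ^ (t + 1), 0) ∉ L ∧
      ∀ i, 1 ≤ i → i ≤ q + 2 → (y * push q ^ t, i) ∉ L) :
    Built u M (K ∪ {x | ∃ t < j, x = y * push q ^ t})
      (L ∪ {p | ∃ t < j, p = (y * push q ^ (t + 1), 0) ∨ p ∈ columnLabels (y * push q ^ t)}) := by
  induction j with
  | zero => simpa using h
  | succ j ih =>
    have h1 := ih (by omega) (fun t ht => hL t (by omega))
    obtain ⟨m1, m2, m3⟩ := ring_mem (y * push q ^ j)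
    rw [mul_assoc y, ← pow_succ] at m2
    have n0 : ∀ t < j, y * push q ^ (j + 1) ≠ y * push q ^ (t + 1) := fun t ht heq => by
      rw [push_pow_inj (by omega) (by omega)] at heq; omega
    have n1 : ∀ t < j, y * push q ^ j ≠ y * push q ^ t := fun t ht heq => by
      rw [push_pow_inj (by omega) (by omega)] at heq; omega
    obtain ⟨l1, l2⟩ := hL j (by omega)
    have hcol : ∀ i, 1 ≤ i → i ≤ q + 2 → (y * push q ^ j, i) ∉ (L ∪ {p | ∃ t < j,
        p = (y * push q ^ (t + 1), 0) ∨ p ∈ columnLabels (y * push q ^ t)}) := by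
      intro i hi hiq
      rintro (h | ⟨t, ht, h | h⟩)
      · exact l2 i hi hiq h
      · have := congrArg Prod.snd h
        simp only at this; omega
      · exact n1 t ht h.1
    -- The triple at `y * push q ^ j` brings in the next label `0` and the label `q + 1` of the
    -- current column, from which the whole column follows.
    have h2 := h1.grow_aux hq m1 m2 m3 ?_ ?_ (hcol _ (by omega) (by omega)) (by simp)
      ⟨sameEnd_mul_push hq hy _, by simp⟩ ⟨sameEnd_mul_push hq hy _, by simp⟩
    · have h3 := h2.column hq (sameEnd_mul_push hq hy j) (Or.inr rfl) (by simp)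
        (fun i hi hiq hne => by
          rintro (h | h | h)
          · exact hcol i hi hiq h
          · have := congrArg Prod.snd h
            simp only at this; omega
          · exact hne (congrArg Prod.snd h))
      have h4 := h3.mono (K' := K ∪ {x | ∃ t < j + 1, x = y * push q ^ t}) ?_
        (h.subset.trans Set.subset_union_left)
      · convert h4 using 1
        ext ⟨a, i⟩
        constructor
        · rintro (h | ⟨t, ht, h⟩)
          · exact Or.inl (Or.inl (Or.inl h))
          · rcases Nat.lt_succ_iff_lt_or_eq.1 ht with ht | rfl
            · exact Or.inl (Or.inl (Or.inr ⟨t, ht, h⟩))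
            · rcases h with h | h
              · exact Or.inl (Or.inr (Or.inl h))
              · exact Or.inr h
        · rintro (((h | ⟨t, ht, h⟩) | h | h) | h)
          · exact Or.inl h
          · exact Or.inr ⟨t, by omega, h⟩
          · exact Or.inr ⟨j, by omega, Or.inl h⟩
          · simp only [Set.mem_singleton_iff, Prod.mk.injEq] at h
            obtain ⟨rfl, rfl⟩ := h
            exact Or.inr ⟨j, by omega, Or.inr ⟨rfl, by simp, by simp⟩⟩
          · exact Or.inr ⟨j, by omega, Or.inr h⟩
      · rintro x (hx | ⟨t, ht, rfl⟩)
        · exact Or.inl (Or.inl hx)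
        · rcases Nat.lt_succ_iff_lt_or_eq.1 ht with ht | rfl
          · exact Or.inl (Or.inr ⟨t, ht, rfl⟩)
          · exact Or.inr (Or.inl rfl)
    · rcases j with _ | j
      · exact Or.inl (by simpa using hyL)
      · exact Or.inr ⟨j, by omega, Or.inl rfl⟩
    · rintro (h | ⟨t, ht, h | h⟩)
      · exact l1 h
      · exact n0 t ht (congrArg Prod.fst h)
      · have := h.2.1
        simp only at this; omega

end Growth

/-! ### The root coset of `⟨push q⟩` and the attachment of further cosets. -/

section Classes

variable {q : ℕ} {u : Perm (Fin (q + 4))} {M K : Set (Perm (Fin (q + 4)))}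
  {L : Set (Perm (Fin (q + 4)) × ℕ)}

/-- The coset of `⟨push q⟩` that contains `u`. -/
def pushCoset (u : Perm (Fin (q + 4))) : Set (Perm (Fin (q + 4))) :=
  {x | ∃ t < q + 2, x = u * push q ^ t}

theorem mul_push_pow_mem_pushCoset (u : Perm (Fin (q + 4))) (t : ℕ) :
    u * push q ^ t ∈ pushCoset u := by
  refine ⟨t % (q + 2), Nat.mod_lt _ (by omega), ?_⟩
  have h := pow_mod_orderOf (push q) t
  rw [orderOf_push] at h
  rw [h]

theorem mul_push_mem_pushCoset {u x : Perm (Fin (q + 4))} (hx : x ∈ pushCoset u) :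
    x * push q ∈ pushCoset u := by
  obtain ⟨t, -, rfl⟩ := hx
  rw [mul_assoc, ← pow_succ]
  exact mul_push_pow_mem_pushCoset u _

/-- All labels over a set of permutations. -/
def allLabels (X : Set (Perm (Fin (q + 4)))) : Set (Perm (Fin (q + 4)) × ℕ) :=
  {p | p.1 ∈ X ∧ p.2 ≤ q + 2}

theorem mem_allLabels_pushCoset {u y : Perm (Fin (q + 4))} {i : ℕ} :
    (y, i) ∈ allLabels (pushCoset u) ↔
      ∃ t ≤ q + 1, y = u * push q ^ t ∧ (i = 0 ∨ (1 ≤ i ∧ i ≤ q + 2)) := by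
  constructor
  · rintro ⟨⟨t, ht, h⟩, hi⟩
    simp only at hi h
    exact ⟨t, by omega, h, by omega⟩
  · rintro ⟨t, ht, h, hi⟩
    exact ⟨⟨t, by omega, h⟩, by simp only; omega⟩

theorem Built.close (hq : Odd q) (h : Built u ∅ K L) {x : Perm (Fin (q + 4))}
    {p p' p'' : Perm (Fin (q + 4)) × ℕ} (hx : x ∈ necklace p)
    (hx' : x * window q (q + 1) ∈ necklace p')
    (hx'' : x * window q (q + 1) * window q (q + 1) ∈ necklace p'') (hp : p ∈ L)
    (hp' : p' ∈ L) (hp'' : p'' ∉ L) (hv'' : ValidLabel u p'')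
    (hM : ∀ w ∈ M, (∃ p ∈ L, w ∈ necklace p) ∧ w * push q ∈ M) (hxM : x ∈ M)
    (hMK : ∀ w ∈ M, w = x ∨ w ∈ K) : Built u M M (L ∪ {p''}) := by
  obtain ⟨F, hF⟩ := h.2
  have hr : (push q * (rot q)⁻¹) ^ 3 = 1 := by rw [push_eq, window_pow _ _ (by omega)]
  have hG := hF.close hr (rot_ne_push q) (push_eq q).symm (x := x) ⟨p, hp, hx⟩
    ⟨p', hp', hx'⟩ (h.notMem hq hv'' hp'' hx'') hM hxM hMK
  refine ⟨?_, F * tripleCycle x (window q (q + 1)), ?_⟩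
  · rintro r (hr | rfl)
    · exact h.1 r hr
    · exact hv''
  · convert hG using 1
    ext w
    constructor
    · rintro ⟨r, hr | rfl, hw⟩
      · exact Or.inl ⟨r, hr, hw⟩
      · exact Or.inr ((mem_necklace_iff hx'').1 hw)
    · rintro (⟨r, hr, hw⟩ | ⟨c, hc, rfl⟩)
      · exact ⟨r, Or.inl hr, hw⟩
      · exact ⟨p'', Or.inr rfl, mul_mem_necklace hx'' hc⟩

/-- A partial cycle on all necklaces over a coset of `⟨push q⟩`, with this coset missing. -/
theorem built_root (hq : Odd q) (u : Perm (Fin (q + 4))) :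
    Built u (pushCoset u) (pushCoset u) (allLabels (pushCoset u)) := by
  have hu : u ∈ sameEnd u := ⟨rfl, fun _ _ => rfl⟩
  have hu0 : u ∈ necklace (u, 0) := (ring_mem u).1
  have h0 : Built u ∅ ∅ {(u, 0)} := by
    refine ⟨?_, Equiv.mulRight (rot q), ?_⟩
    · rintro _ rfl
      exact ⟨hu, by simp⟩
    · convert PartialCycle.init (rot_ne_push q) u using 1
      ext w
      simp only [Set.mem_singleton_iff, exists_eq_left, Set.mem_ofPred_eq]
      exact mem_necklace_iff hu0
  have h1 := h0.ring hq hu rfl (j := q + 1) le_rfl (fun t ht => ⟨fun h => by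
      have := congrArg Prod.fst h
      simp only at this
      rw [← mul_one u, ← pow_zero (push q), mul_assoc, ← pow_add,
        push_pow_inj (by omega) (by omega)] at this
      omega, fun i hi _ h => by
      have := congrArg Prod.snd h
      simp only at this
      omega⟩)
  -- The last triple of the ring wraps round to `(u, 0)`, so two of its necklaces are already
  -- present. Switching it makes all of `pushCoset u` use `push q`, and the coset splits off as a
  -- cycle of its own.
  obtain ⟨m1, m2, m3⟩ := ring_mem (u * push q ^ (q + 1))
  rw [mul_assoc u, ← pow_succ, push_pow_eq_one, mul_one] at m2
  have hz : ∀ t ≤ q + 1, (u * push q ^ t, 0) ∈ ({(u, 0)} : Set (Perm (Fin (q + 4)) × ℕ)) ∪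
      {p | ∃ t < q + 1, p = (u * push q ^ (t + 1), 0) ∨ p ∈ columnLabels (u * push q ^ t)} := by
    intro t ht
    rcases t with _ | t
    · exact Or.inl (by simp)
    · exact Or.inr ⟨t, by omega, Or.inl rfl⟩
  have hcol : ∀ i, 1 ≤ i → (u * push q ^ (q + 1), i) ∉
      ({(u, 0)} : Set (Perm (Fin (q + 4)) × ℕ)) ∪
      {p | ∃ t < q + 1, p = (u * push q ^ (t + 1), 0) ∨ p ∈ columnLabels (u * push q ^ t)} := by
    intro i hi
    rintro (h | ⟨t, ht, h | h⟩)
    · have := congrArg Prod.snd h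
      simp only at this; omega
    · have := congrArg Prod.snd h
      simp only at this; omega
    · have := h.1
      simp only at this
      rw [push_pow_inj (by omega) (by omega)] at this
      omega
  have h2 := h1.close hq (M := pushCoset u) m1 m2 m3 (hz _ le_rfl) (Or.inl rfl)
    (hcol _ (by omega)) ⟨sameEnd_mul_push hq hu _, by simp⟩ (by
      rintro w ⟨t, ht, rfl⟩
      exact ⟨⟨_, hz t (by omega), (ring_mem _).1⟩,
        mul_push_mem_pushCoset (mul_push_pow_mem_pushCoset u t)⟩)
    (mul_push_pow_mem_pushCoset u _) (by
      rintro w ⟨t, ht, rfl⟩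
      rcases Nat.lt_succ_iff_lt_or_eq.1 ht with ht | rfl
      · exact Or.inr (Or.inr ⟨t, ht, rfl⟩)
      · exact Or.inl rfl)
  have h3 := h2.column hq (sameEnd_mul_push hq hu _) (Or.inr rfl) (Or.inr rfl) (by
    rintro i hi hiq hne (h | h)
    · exact hcol i hi h
    · exact hne (congrArg Prod.snd h))
  convert h3 using 1
  ext ⟨y, i⟩
  rw [mem_allLabels_pushCoset]
  constructor
  · rintro ⟨t, ht, rfl, rfl | hi⟩
    · exact Or.inl (Or.inl (hz t ht))
    · rcases Nat.lt_succ_iff_lt_or_eq.1 (Nat.lt_succ_of_le ht) with ht | rfl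
      · exact Or.inl (Or.inl (Or.inr ⟨t, ht, Or.inr ⟨rfl, hi⟩⟩))
      · exact Or.inr ⟨rfl, hi⟩
  · rintro (((h | ⟨t, ht, h | ⟨h, hi⟩⟩) | h) | ⟨h, hi⟩)
    · simp only [Set.mem_singleton_iff, Prod.mk.injEq] at h
      exact ⟨0, by omega, by simp [h.1], Or.inl h.2⟩
    · simp only [Prod.mk.injEq] at h
      exact ⟨t + 1, by omega, h.1, Or.inl h.2⟩
    · exact ⟨t, by omega, h, Or.inr hi⟩
    · simp only [Set.mem_singleton_iff, Prod.mk.injEq] at h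
      exact ⟨q + 1, le_rfl, h.1, Or.inr (by omega)⟩
    · exact ⟨q + 1, le_rfl, h, Or.inr hi⟩

/-- Extending a partial cycle to the necklaces over a further coset of `⟨push q⟩`. -/
theorem Built.extend (hq : Odd q) {X : Set (Perm (Fin (q + 4)))} (h : Built u M K (allLabels X))
    {z : Perm (Fin (q + 4))} (hzu : z ∈ sameEnd u) (hz : ∀ t, z * push q ^ t ∉ X)
    (hd : z * doubleSwap q ∈ X) : Built u M K (allLabels (X ∪ pushCoset z)) := by
  have hq1 : 1 ≤ q := hq.pos
  have hv : ∀ t i, i ≤ q + 2 → ValidLabel u (z * push q ^ t, i) := fun t i hi =>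
    ⟨sameEnd_mul_push hq hzu t, hi⟩
  have hX : ∀ t i, (z * push q ^ t, i) ∉ allLabels X := fun t i hi => hz t hi.1
  have hinj : ∀ {s t}, s < q + 2 → t < q + 2 → s ≠ t → z * push q ^ s ≠ z * push q ^ t :=
    fun hs ht hst heq => hst ((push_pow_inj hs ht z).1 heq)
  have n1 : z * push q ^ q ≠ z * push q ^ (q + 1) := hinj (by omega) (by omega) (by omega)
  have h1 := h.grow hq (mergeable_link hq z).rotate.rotate ⟨hd, le_rfl⟩ (hX _ _) (hX _ _)
    (by simp) (hv _ _ (by omega)) (hv _ _ (by omega))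
  have h2 := h1.column hq (sameEnd_mul_push hq hzu q) (Or.inl rfl) (by simp) (by
    rintro i hi hiq hne (h | h | h)
    · exact hX _ _ h
    · exact hne (congrArg Prod.snd h)
    · exact n1 (congrArg Prod.fst h))
  have h3 := h2.column hq (sameEnd_mul_push hq hzu (q + 1)) (Or.inr rfl) (by simp) (by
    rintro i hi hiq hne ((h | h | h) | h)
    · exact hX _ _ h
    · exact n1 (congrArg Prod.fst h).symm
    · exact hne (congrArg Prod.snd h)
    · exact n1 h.1.symm)
  -- The column at exponent `q + 1` is present, so the ring triple there can be entered through its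
  -- label `q + 1` and brings in two labels `0` at once.
  have hm : Mergeable (z * push q ^ (q + 1), 0) (z * push q ^ 0, 0)
      (z * push q ^ (q + 1), q + 1) := by
    obtain ⟨m1, m2, m3⟩ := ring_mem (z * push q ^ (q + 1))
    rw [mul_assoc z, ← pow_succ, push_pow_eq_one, ← pow_zero (push q)] at m2
    exact ⟨_, m1, m2, m3⟩
  have n2 : z * push q ^ (q + 1) ≠ z * push q ^ 0 := hinj (by omega) (by omega) (by omega)
  have hzero : ∀ t, (z * push q ^ t, 0) ∉ ((allLabels X ∪ {(z * push q ^ q, q),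
      (z * push q ^ (q + 1), q + 1)}) ∪ columnLabels (z * push q ^ q)) ∪
        columnLabels (z * push q ^ (q + 1)) := by
    rintro t (((h | h | h) | h) | h)
    · exact hX _ _ h
    · have := congrArg Prod.snd h
      simp only at this; omega
    · have := congrArg Prod.snd h
      simp only at this; omega
    · exact absurd h.2.1 (by simp)
    · exact absurd h.2.1 (by simp)
  have h4 := h3.grow hq hm.rotate.rotate (by simp) (hzero _) (hzero _) (by simpa using n2)
    (hv _ _ (by omega)) (hv _ _ (by omega))
  -- The ring stops at exponent `q`: the triple at `z * push q ^ q` is left unswitched, so this ring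
  -- does not close.
  have h5 := h4.ring hq hzu (j := q) (by simp) (by omega) (fun t ht => ⟨?_, ?_⟩)
  · have h6 := h5.mono Set.subset_union_left h.subset
    convert h6 using 1
    ext ⟨y, i⟩
    have e : (y, i) ∈ allLabels (X ∪ pushCoset z) ↔
        (y, i) ∈ allLabels X ∨ (y, i) ∈ allLabels (pushCoset z) := by
      simp only [allLabels, Set.mem_ofPred_eq, Set.mem_union]; tauto
    rw [e, mem_allLabels_pushCoset]
    constructor
    · rintro (h | ⟨t, ht, rfl, rfl | hi⟩)
      · exact Or.inl (Or.inl (Or.inl (Or.inl (Or.inl h))))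
      · rcases t with _ | t
        · exact Or.inl (Or.inr (by simp))
        · rcases (show t < q ∨ t = q by omega) with ht | rfl
          · exact Or.inr ⟨t, ht, Or.inl rfl⟩
          · exact Or.inl (Or.inr (by simp))
      · rcases (show t < q ∨ t = q ∨ t = q + 1 by omega) with ht | rfl | rfl
        · exact Or.inr ⟨t, ht, Or.inr ⟨rfl, hi⟩⟩
        · exact Or.inl (Or.inl (Or.inl (Or.inr ⟨rfl, hi⟩)))
        · exact Or.inl (Or.inl (Or.inr ⟨rfl, hi⟩))
    · rintro ((((((h | h | h) | h) | h) | h | h)) | ⟨t, ht, h | h⟩)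
      · exact Or.inl h
      · simp only [Prod.mk.injEq] at h
        exact Or.inr ⟨q, by omega, h.1, by omega⟩
      · simp only [Set.mem_singleton_iff, Prod.mk.injEq] at h
        exact Or.inr ⟨q + 1, by omega, h.1, by omega⟩
      · exact Or.inr ⟨q, by omega, h.1, Or.inr h.2⟩
      · exact Or.inr ⟨q + 1, by omega, h.1, Or.inr h.2⟩
      · simp only [Prod.mk.injEq] at h
        exact Or.inr ⟨q + 1, by omega, h.1, by omega⟩
      · simp only [Set.mem_singleton_iff, Prod.mk.injEq] at h
        exact Or.inr ⟨0, by omega, h.1, by omega⟩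
      · simp only [Prod.mk.injEq] at h
        exact Or.inr ⟨t + 1, by omega, h.1, by omega⟩
      · exact Or.inr ⟨t, by omega, h.1, Or.inr h.2⟩
  · rintro (h | h | h)
    · exact hzero _ h
    · exact hinj (by omega) (by omega) (by omega) (congrArg Prod.fst h)
    · exact hinj (by omega) (by omega) (by omega) (congrArg Prod.fst h)
  · rintro i hi hiq ((((h | h | h) | h) | h) | h | h)
    · exact hX _ _ h
    · exact hinj (by omega) (by omega) (by omega) (congrArg Prod.fst h)
    · exact hinj (by omega) (by omega) (by omega) (congrArg Prod.fst h)
    · exact hinj (by omega) (by omega) (by omega) h.1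
    · exact hinj (by omega) (by omega) (by omega) h.1
    · have := congrArg Prod.snd h
      simp only at this; omega
    · have := congrArg Prod.snd h
      simp only at this; omega

end Classes

/-! ### Generation of the alternating group and exhaustion of `sameEnd u`. -/

section Connectivity

/-- The inclusion of the permutations of the first `k` letters. -/
noncomputable def firstLetters {k n : ℕ} (h : k ≤ n) : Perm (Fin k) →* Perm (Fin n) :=
  viaEmbeddingHom (Fin.castLEEmb h)

theorem firstLetters_castLE {k n : ℕ} (h : k ≤ n) (g : Perm (Fin k)) (i : Fin k) :
    firstLetters h g (i.castLE h) = (g i).castLE h :=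
  viaEmbedding_apply g (Fin.castLEEmb h) i

theorem firstLetters_of_le {k n : ℕ} (h : k ≤ n) (g : Perm (Fin k)) {i : Fin n}
    (hi : k ≤ (i : ℕ)) : firstLetters h g i = i := by
  refine viaEmbedding_apply_of_notMem g (Fin.castLEEmb h) i ?_
  rintro ⟨j, rfl⟩
  exact absurd j.2 (not_lt.2 hi)

theorem firstLetters_injective {k n : ℕ} (h : k ≤ n) : Function.Injective (firstLetters h) :=
  viaEmbeddingHom_injective _

theorem firstLetters_eq {k n : ℕ} (h : k ≤ n) {g : Perm (Fin k)} {e : Perm (Fin n)}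
    (h1 : ∀ i : Fin k, e (i.castLE h) = (g i).castLE h)
    (h2 : ∀ i : Fin n, k ≤ (i : ℕ) → e i = i) : firstLetters h g = e := by
  ext1 i
  by_cases hi : (i : ℕ) < k
  · rw [show i = (⟨i, hi⟩ : Fin k).castLE h from rfl, firstLetters_castLE, h1]
  · rw [firstLetters_of_le h g (not_lt.1 hi), h2 i (not_lt.1 hi)]

theorem sign_firstLetters {k n : ℕ} (h : k ≤ n) (g : Perm (Fin k)) :
    sign (firstLetters h g) = sign g := by
  show sign (viaEmbedding g (Fin.castLEEmb h)) = sign g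
  rw [viaEmbedding, sign_extendDomain]

theorem firstLetters_swap {k n : ℕ} (h : k ≤ n) (a b : Fin k) :
    firstLetters h (swap a b) = swap (a.castLE h) (b.castLE h) := by
  refine firstLetters_eq h (fun i => ?_) fun i hi => ?_
  · exact (Fin.castLE_injective h).map_swap a b i |>.symm
  · refine swap_apply_of_ne_of_ne ?_ ?_ <;> rintro rfl
    · exact absurd a.2 (not_lt.2 hi)
    · exact absurd b.2 (not_lt.2 hi)

theorem firstLetters_cycleRange {k n : ℕ} (h : k ≤ n) (j : Fin k) :
    firstLetters h (Fin.cycleRange j) = Fin.cycleRange (j.castLE h) := by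
  refine firstLetters_eq h (fun i => ?_) fun i hi => ?_
  · have : NeZero k := ⟨by have := i.2; omega⟩
    have : NeZero n := ⟨by have := i.2; omega⟩
    rcases lt_trichotomy i j with hij | rfl | hij
    · apply Fin.ext
      rw [Fin.val_castLE, Fin.coe_cycleRange_of_lt hij, Fin.coe_cycleRange_of_lt]
      · rfl
      · exact hij
    · rw [Fin.cycleRange_self, Fin.cycleRange_self]
      rfl
    · rw [Fin.cycleRange_of_gt hij, Fin.cycleRange_of_gt]
      exact hij
  · exact Fin.cycleRange_of_gt (Fin.lt_def.2 (lt_of_lt_of_le j.2 hi))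

theorem exists_firstLetters {k n : ℕ} (h : k ≤ n) {e : Perm (Fin n)}
    (he : ∀ i : Fin n, k ≤ (i : ℕ) → e i = i) : ∃ g, firstLetters h g = e := by
  have hlt : ∀ i : Fin k, ((e (i.castLE h) : Fin n) : ℕ) < k := by
    intro i
    by_contra hc
    have h1 := e.injective (he _ (not_lt.1 hc))
    rw [h1] at hc
    exact hc i.2
  refine ⟨Equiv.ofBijective (fun i => ⟨e (i.castLE h), hlt i⟩)
    (Finite.injective_iff_bijective.1 fun i j hij => ?_), firstLetters_eq h (fun i => rfl) he⟩
  have := e.injective (Fin.ext (Fin.mk.inj_iff.1 hij))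
  exact Fin.castLE_injective h this

/-- For odd `q + 2`, a rotation of all letters and a pair of adjacent transpositions next to each
other in cyclic order generate the alternating group. -/
theorem mem_of_finRotate_mem {q : ℕ} (hq : Odd q) {H : Subgroup (Perm (Fin (q + 2)))}
    (h1 : finRotate (q + 2) ∈ H)
    (h2 : swap ⟨0, by omega⟩ ⟨1, by omega⟩ * swap ⟨q, by omega⟩ ⟨q + 1, by omega⟩ ∈ H)
    {g : Perm (Fin (q + 2))} (hg : sign g = 1) : g ∈ H := by
  set s : Fin (q + 2) → Perm (Fin (q + 2)) := fun i => swap i (i + 1) with hs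
  have hss : ∀ i, s i * s i = 1 := fun i => swap_mul_self _ _
  have hss' : ∀ i, (s i)⁻¹ = s i := fun i => swap_inv _ _
  have hrot : ∀ n : ℕ, ∀ k, ((finRotate (q + 2)) ^ n) k = k + Fin.ofNat (q + 2) n := by
    intro n
    induction n with
    | zero => intro k; simp
    | succ n ih =>
      intro k
      rw [pow_succ', mul_apply, ih, finRotate_apply, add_assoc]
      congr 1
      apply Fin.ext
      simp [Fin.val_add]
  have hd : swap ⟨0, by omega⟩ ⟨1, by omega⟩ * swap ⟨q, by omega⟩ ⟨q + 1, by omega⟩ =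
      s (⟨q, by omega⟩ + 1 + 1) * s ⟨q, by omega⟩ := by
    have e1 : (⟨q, by omega⟩ + 1 : Fin (q + 2)) = ⟨q + 1, by omega⟩ := by
      apply Fin.ext; simp [Fin.val_add]
    have e2 : (⟨q + 1, by omega⟩ + 1 : Fin (q + 2)) = ⟨0, by omega⟩ := by
      apply Fin.ext; simp [Fin.val_add]
    have e3 : (⟨0, by omega⟩ + 1 : Fin (q + 2)) = ⟨1, by omega⟩ := by
      apply Fin.ext; simp
    simp only [hs, e1, e2, e3]
  rw [hd] at h2
  have hconj : ∀ i, s (i + 1 + 1) * s i ∈ H := by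
    intro i
    set w := finRotate (q + 2) ^ ((i - ⟨q, by omega⟩ : Fin (q + 2)) : ℕ) with hw
    have hwk : ∀ k, w k = k + (i - ⟨q, by omega⟩) := fun k => by rw [hw, hrot]; simp
    have hws : ∀ a, w * s a * w⁻¹ = s (w a) := fun a => by
      simp only [hs]
      rw [← swap_apply_apply]
      congr 1
      rw [hwk, hwk]; abel
    have hmem : w * (s (⟨q, by omega⟩ + 1 + 1) * s ⟨q, by omega⟩) * w⁻¹ ∈ H :=
      H.mul_mem (H.mul_mem (pow_mem h1 _) h2) (H.inv_mem (pow_mem h1 _))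
    have e : w * (s (⟨q, by omega⟩ + 1 + 1) * s ⟨q, by omega⟩) * w⁻¹ =
        (w * s (⟨q, by omega⟩ + 1 + 1) * w⁻¹) * (w * s ⟨q, by omega⟩ * w⁻¹) := by group
    rw [e, hws, hws, hwk, hwk] at hmem
    convert hmem using 3 <;> abel
  have heven : ∀ n : ℕ, s (Fin.ofNat (q + 2) (2 * n)) * s 0 ∈ H := by
    intro n
    induction n with
    | zero =>
      have : (Fin.ofNat (q + 2) (2 * 0)) = 0 := rfl
      rw [this, hss]
      exact H.one_mem
    | succ n ih =>
      have := H.mul_mem (hconj (Fin.ofNat (q + 2) (2 * n))) ih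
      rw [mul_assoc, ← mul_assoc (s (Fin.ofNat (q + 2) (2 * n))), hss, one_mul] at this
      convert this using 3
      apply Fin.ext
      simp [Fin.val_add, mul_add]
  have hall : ∀ i, s i * s 0 ∈ H := by
    intro i
    obtain ⟨a, rfl⟩ := hq
    rcases Nat.even_or_odd' (i : ℕ) with ⟨c, hc | hc⟩
    · convert heven c using 3
      apply Fin.ext
      simp only [Fin.ofNat]
      rw [← hc, Nat.mod_eq_of_lt i.2]
    -- Since `q + 2` is odd, an odd `i` is congruent to the even number `i + (q + 2)`.
    · convert heven (c + a + 2) using 3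
      apply Fin.ext
      simp only [Fin.ofNat]
      rw [show 2 * (c + a + 2) = i + (2 * a + 1 + 2) by omega, Nat.add_mod_right,
        Nat.mod_eq_of_lt i.2]
  have hall' : ∀ i, s 0 * s i ∈ H := fun i => by
    have := H.inv_mem (hall i)
    rwa [mul_inv_rev, hss', hss'] at this
  -- Induction on words in adjacent transpositions passes through odd elements, which are made even
  -- by the fixed factor `s 0`.
  have key : ∀ g : Perm (Fin (q + 2)), (sign g = 1 → g ∈ H) ∧ (sign g = -1 → s 0 * g ∈ H) := by
    intro g
    have hgm : g ∈ Submonoid.closure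
        (Set.range fun i : Fin (q + 1) => swap i.castSucc i.succ) := by
      rw [mclosure_swap_castSucc_succ]; trivial
    induction hgm using Submonoid.closure_induction_left with
    | one => exact ⟨fun _ => H.one_mem, fun h => by simp at h⟩
    | mul_left x hx y _ ih =>
      obtain ⟨i, rfl⟩ := hx
      have hi : swap i.castSucc i.succ = s i.castSucc := by
        simp only [hs, Fin.coeSucc_eq_succ]
      have hsg : sign (swap i.castSucc i.succ * y) = - sign y := by
        rw [Perm.sign_mul, sign_swap (Fin.castSucc_lt_succ).ne, neg_one_mul]
      simp only [hsg]
      rw [hi]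
      constructor
      · intro h
        have := H.mul_mem (hall i.castSucc) (ih.2 (by rw [← h, neg_neg]))
        rwa [mul_assoc, ← mul_assoc (s 0), hss, one_mul] at this
      · intro h
        have := H.mul_mem (hall' i.castSucc) (ih.1 (neg_inj.1 h))
        rwa [mul_assoc] at this
  exact (key g).1 hg

theorem firstLetters_finRotate (q : ℕ) :
    firstLetters (Nat.le_add_right (q + 2) 2) (finRotate (q + 2))⁻¹ = push q := by
  rw [map_inv, push, ← Fin.cycleRange_last, firstLetters_cycleRange]
  rfl

/-- The elements of `sameEnd u` are connected by right multiplication by `push q` and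
`doubleSwap q`. -/
theorem eq_sameEnd {q : ℕ} (hq : Odd q) {u : Perm (Fin (q + 4))} {X : Set (Perm (Fin (q + 4)))}
    (huX : u ∈ X) (hX : ∀ x ∈ X, x ∈ sameEnd u) (h1 : ∀ x ∈ X, x * push q ∈ X)
    (h2 : ∀ z ∈ sameEnd u, z * doubleSwap q ∈ X → z ∈ X) : X = sameEnd u := by
  refine Set.Subset.antisymm hX fun y hy => ?_
  have hq1 : 1 ≤ q := hq.pos
  have hle : q + 2 ≤ q + 4 := by omega
  -- The stabilizer of `X` under right multiplication; once it contains the alternating group, `X`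
  -- contains all of `sameEnd u`.
  let H : Subgroup (Perm (Fin (q + 2))) :=
    { carrier := {g | ∀ x, x * firstLetters hle g ∈ X ↔ x ∈ X}
      mul_mem' := fun {a b} ha hb x => by rw [map_mul, ← mul_assoc, hb, ha]
      one_mem' := fun x => by simp
      inv_mem' := fun {a} ha x => by
        have := ha (x * (firstLetters hle a)⁻¹)
        rw [inv_mul_cancel_right] at this
        rw [map_inv, this] }
  have hdd : firstLetters hle (swap ⟨0, by omega⟩ ⟨1, by omega⟩ *
      swap ⟨q, by omega⟩ ⟨q + 1, by omega⟩) = doubleSwap q := by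
    rw [map_mul, firstLetters_swap, firstLetters_swap]
    rfl
  have hdfix : ∀ k : Fin (q + 4), q + 2 ≤ (k : ℕ) → (doubleSwap q)⁻¹ k = k := fun k hk => by
    rw [← hdd, ← map_inv]
    exact firstLetters_of_le hle _ hk
  have hdsign : sign (doubleSwap q)⁻¹ = 1 := by
    rw [sign_inv, doubleSwap, Perm.sign_mul, sign_swap (by simp), sign_swap (by simp)]
    rfl
  have hrot : finRotate (q + 2) ∈ H := by
    rw [← inv_mem_iff]
    intro x
    rw [firstLetters_finRotate]
    exact mul_mem_of_closed h1 (Subgroup.mem_zpowers _)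
  have hd : swap ⟨0, by omega⟩ ⟨1, by omega⟩ * swap ⟨q, by omega⟩ ⟨q + 1, by omega⟩ ∈ H := by
    intro x
    rw [hdd]
    have hcl : ∀ x ∈ X, x * (doubleSwap q)⁻¹ ∈ X := fun x hx =>
      h2 _ (sameEnd_mul (hX x hx) hdsign hdfix) (by simpa using hx)
    exact mul_mem_of_closed hcl (by
      rw [Subgroup.zpowers_inv]; exact Subgroup.mem_zpowers _)
  obtain ⟨g, hg⟩ := exists_firstLetters hle (e := u⁻¹ * y) (fun k hk => by
    rw [mul_apply, hy.2 k hk]; simp)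
  have hgs : sign g = 1 := by
    rw [← sign_firstLetters hle, hg, Perm.sign_mul, sign_inv, hy.1]
    exact Int.units_mul_self _
  have := (mem_of_finRotate_mem hq hrot hd hgs u).2 huX
  rwa [hg, mul_inv_cancel_left] at this

/-- Take a maximal set `X`, closed under `push q`, over which a partial cycle exists. If it were not
everything, `eq_sameEnd` would provide `z ∉ X` with `z * doubleSwap q ∈ X`; the coset of `z` is then
disjoint from `X` and can be attached, against maximality. -/
theorem built_sameEnd {q : ℕ} (hq : Odd q) (u : Perm (Fin (q + 4))) :
    Built u (pushCoset u) (pushCoset u) (allLabels (sameEnd u)) := by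
  classical
  have hsub : ∀ z ∈ sameEnd u, pushCoset z ⊆ sameEnd u := by
    rintro z hz _ ⟨t, -, rfl⟩
    exact sameEnd_mul_push hq hz t
  let P : Set (Perm (Fin (q + 4))) → Prop := fun X => u ∈ X ∧ (∀ x ∈ X, x * push q ∈ X) ∧
    Built u (pushCoset u) (pushCoset u) (allLabels X)
  have hu : u ∈ sameEnd u := ⟨rfl, fun _ _ => rfl⟩
  obtain ⟨X, ⟨h1, h2, h3⟩, hmax⟩ := Set.Finite.exists_maximal (s := {X | P X}) (Set.toFinite _)
    ⟨pushCoset u, ⟨0, by omega, by simp⟩, fun x hx => mul_push_mem_pushCoset hx, built_root hq u⟩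
  have hX : ∀ x ∈ X, x ∈ sameEnd u := fun x hx => (h3.1 (x, 0) ⟨hx, Nat.zero_le _⟩).1
  rwa [← eq_sameEnd hq h1 hX h2 fun z hz hzd => ?_]
  by_contra hzX
  have hzt : ∀ t, z * push q ^ t ∉ X := fun t ht => hzX ((mul_mem_of_closed h2
    (Subgroup.npow_mem_zpowers _ t)).1 ht)
  have hb := h3.extend hq hz hzt hzd
  refine hzX (hmax (y := X ∪ pushCoset z) ⟨Or.inl h1, ?_, hb⟩ Set.subset_union_left
    (Or.inr ⟨0, by omega, by simp⟩))
  rintro x (hx | hx)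
  · exact Or.inl (h2 x hx)
  · exact Or.inr (mul_push_mem_pushCoset hx)

end Connectivity

/-! ### Reading the code off the cycle through the identity. -/

section Code

theorem necklace_sign {q : ℕ} (hq : Odd q) {u x y : Perm (Fin (q + 4))} {i : ℕ}
    (hy : y ∈ sameEnd u) (hx : x ∈ necklace (y, i)) : sign x = sign u := by
  obtain ⟨c, ⟨n, rfl⟩, rfl⟩ := hx
  simp [Perm.sign_mul, sign_ins, sign_rot hq, hy.1]

theorem ncard_pushCoset {q : ℕ} (u : Perm (Fin (q + 4))) : (pushCoset u).ncard = q + 2 := by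
  have h : pushCoset u = ↑((Finset.range (q + 2)).image fun t => u * push q ^ t) := by
    ext x
    simp [pushCoset, eq_comm]
  rw [h, Set.ncard_coe_finset, Finset.card_image_of_injOn, Finset.card_range]
  intro s hs t ht hst
  exact (push_pow_inj (by simpa using hs) (by simpa using ht) u).1 hst

/-- A cyclic code in the alternating group on `q + 4` letters that uses two transitions only and
misses a coset of `⟨push q⟩`. -/
theorem exists_code {q : ℕ} (hq : Odd q) : ∃ C : List (Perm (Fin (q + 4))),
    C.Nodup ∧ C.IsChain (fun x y => y = x * rot q ∨ y = x * push q) ∧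
    C.head? = some 1 ∧ C.getLast? = some (push q)⁻¹ ∧ (∀ x ∈ C, sign x = 1) ∧
    2 * (C.length + (q + 2)) = (q + 4).factorial ∧ (rot q)⁻¹ ∉ C := by
  classical
  set u := (rot q)⁻¹ with hu
  have husign : sign u = 1 := by rw [hu, sign_inv, sign_rot hq]
  obtain ⟨-, F, hF⟩ := built_sameEnd hq u
  set M := pushCoset u
  have hV : {x | ∃ p ∈ allLabels (sameEnd u), x ∈ necklace p} = {x | sign x = 1} := by
    ext x
    constructor
    · rintro ⟨p, hp, hx⟩
      exact (necklace_sign hq hp.1 hx).trans husign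
    · intro hx
      obtain ⟨y, hy, i, hi, hxy⟩ := exists_necklace hq (u := u) (x := x) (by rw [husign]; exact hx)
      exact ⟨(y, i), ⟨hy, hi⟩, hxy⟩
  rw [hV] at hF
  have hMF : ∀ x ∈ M, F x ∈ M := fun x hx => by
    rw [hF.fixed x (hF.missing x hx).2.1]
    exact (hF.missing x hx).2.2
  have huM : u ∈ M := ⟨0, by omega, by simp⟩
  have h1M : (1 : Perm (Fin (q + 4))) ∉ M := by
    rintro ⟨t, -, ht⟩
    have h1 : rot q = push q ^ t := by
      rw [hu] at ht
      rw [← mul_one (rot q), ht, mul_inv_cancel_left]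
    have h2 : ∀ t : ℕ, (push q ^ t) ⟨q + 3, by omega⟩ = ⟨q + 3, by omega⟩ := fun t => by
      induction t with
      | zero => rfl
      | succ t ih => rw [pow_succ, mul_apply, push_apply_of_le (by simp), ih]
    have h3 := val_rot q ⟨q + 3, by omega⟩
    rw [h1, h2] at h3
    simp at h3
  -- The switched triple through `u = (rot q)⁻¹` ends in `u r² = u r⁻¹ = (push q)⁻¹`, so `push q` is
  -- also the transition used there.
  have hF1 : F (push q)⁻¹ = 1 := by
    have h2 := hF.triple _ (hF.triple u (hF.fixed u huM))
    have h3 : u * (push q * (rot q)⁻¹) * (push q * (rot q)⁻¹) = (push q)⁻¹ := by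
      have h4 := triple_pow (x := u) (window_pow q (q + 1) (by omega))
      rw [← push_eq, ← eq_mul_inv_iff_mul_eq] at h4
      rw [h4, hu]
      group
    rw [h3] at h2
    rw [h2, inv_mul_cancel]
  have hne : ∀ x, F x ≠ x := fun x h => by
    rcases hF.step x with h1 | h1 <;> rw [h1] at h
    · have h2 := val_rot q 0
      rw [mul_eq_left.1 h] at h2
      simp at h2
    · have h2 := val_push q 0
      rw [mul_eq_left.1 h] at h2
      simp at h2
  have h1s : (1 : Perm (Fin (q + 4))) ∈ F.support := mem_support.2 (hne 1)
  have hmem : ∀ x, x ∈ F.toList 1 ↔ sign x = 1 ∧ x ∉ M := by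
    intro x
    rw [mem_toList_iff]
    constructor
    · rintro ⟨h, -⟩
      refine ⟨sameCycle_mem (W := {x | sign x = 1}) (fun w hw => ?_) h sign_one, fun hx => h1M ?_⟩
      · exact hF.closed (rot_ne_push q) w hw
      · exact sameCycle_mem hMF h.symm hx
    · rintro ⟨h, hx⟩
      exact ⟨hF.conn 1 sign_one h1M x h hx, h1s⟩
  have hlen : 0 < (F.toList 1).length := (length_toList_pos_of_mem_support _ _ h1s)
  have hget0 : (F.toList 1)[0] = 1 := by rw [getElem_toList]; rfl
  refine ⟨F.toList 1, nodup_toList _ _, ?_, ?_, ?_, fun x hx => ((hmem x).1 hx).1, ?_,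
    fun h => ((hmem u).1 h).2 huM⟩
  · rw [List.isChain_iff_getElem]
    intro i hi
    rw [getElem_toList, getElem_toList, pow_succ', mul_apply]
    exact hF.step _
  · rw [List.head?_eq_getElem?, List.getElem?_eq_getElem hlen, hget0]
  · rw [List.getLast?_eq_getElem?, List.getElem?_eq_getElem (by omega), getElem_toList]
    congr 1
    -- The last element is the `F`-preimage of `1`, because applying `F` once more completes the
    -- cycle.
    apply F.injective
    rw [hF1, ← mul_apply, ← pow_succ', Nat.sub_add_cancel hlen, length_toList]
    have := pow_mod_card_support_cycleOf_self_apply F (F.cycleOf 1).support.card 1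
    rw [Nat.mod_self] at this
    rw [← this]; rfl
  · have hc : (F.toList 1).length = ({x | sign x = 1} \ M : Set (Perm (Fin (q + 4)))).ncard := by
      rw [← List.toFinset_card_of_nodup (nodup_toList _ _), ← Set.ncard_coe_finset]
      congr 1
      ext x
      simp [hmem]
    have hM : M ⊆ {x | sign x = 1} := fun x hx => (hF.missing x hx).1
    have hcard : ({x | sign x = 1} : Set (Perm (Fin (q + 4)))).ncard * 2 = (q + 4).factorial := by
      have := two_mul_nat_card_alternatingGroup (α := Fin (q + 4))
      rw [Nat.card_perm, Nat.card_fin] at this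
      rw [← this, mul_comm, ← Nat.card_coe_set_eq]
      rfl
    have := Set.ncard_sdiff_add_ncard_of_subset hM
    rw [ncard_pushCoset] at this
    rw [hc, this, mul_comm, hcard]

end Code

/-! ### The permutations `piHat` and the transport of the code to `2m + 2` letters. -/

section Transport

theorem pushToTop_eq {n : ℕ} (j : Fin n) (σ : Perm (Fin n)) :
    pushToTop j σ = σ * (Fin.cycleRange j)⁻¹ := rfl

theorem pushToTop_inv_eq {n : ℕ} (j : Fin n) (σ : Perm (Fin n)) :
    (pushToTop j)⁻¹ σ = σ * Fin.cycleRange j := by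
  rw [inv_eq_iff_eq, pushToTop_eq, mul_inv_cancel_right]

/-- The cycle on all positions times the transposition of the last two is the cycle on all positions
but the last. -/
theorem sigmaTilde_eq (m r : ℕ) :
    sigmaTilde m r = (pushToTop (idxB m))⁻¹ (piHat m r) := by
  rw [sigmaTilde, pushToTop_inv_eq, pushToTop_inv_eq, mul_assoc]
  congr 1
  ext k
  have hk := k.2
  rw [mul_apply]
  rcases lt_or_ge (k : ℕ) (2 * m) with h | h
  · have hB : k < idxB m := h
    have hC : k < idxC m := Fin.lt_def.2 (by simp only [idxC]; omega)
    rw [swap_apply_of_ne_of_ne hB.ne hC.ne, Fin.coe_cycleRange_of_lt hB,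
      Fin.coe_cycleRange_of_lt hC]
  · rcases h.eq_or_lt with h | h
    · have hB : k = idxB m := Fin.ext h.symm
      rw [hB, swap_apply_left, Fin.cycleRange_self, Fin.cycleRange_self]
    · have hC : k = idxC m := Fin.ext (by simp only [idxC]; omega)
      have hBC : idxB m < idxC m := Fin.lt_def.2 (by simp [idxB, idxC])
      rw [hC, swap_apply_right, Fin.cycleRange_of_gt hBC, Fin.coe_cycleRange_of_lt hBC]
      rfl

/-- `phi m` is right multiplication by a fixed `g`, so `piHat m r = g ^ r`, and `g` may equally be
applied on the left. Each entry thus evolves on its own under `g`. -/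
theorem piHat_succ_apply (m r : ℕ) (k : Fin (2 * m + 2)) :
    piHat m (r + 1) k = (Fin.cycleRange (idxA m) * (Fin.cycleRange (idxC m))⁻¹ *
      (Fin.cycleRange (idxC m))⁻¹) (piHat m r k) := by
  set g := Fin.cycleRange (idxA m) * (Fin.cycleRange (idxC m))⁻¹ * (Fin.cycleRange (idxC m))⁻¹
    with hg
  have hphi : ∀ σ, phi m σ = σ * g := fun σ => by
    rw [phi, mul_apply, pushToTop_inv_eq, pow_two, mul_apply, pushToTop_eq, pushToTop_eq, hg]
    simp only [mul_assoc]
  have hpow : ∀ r, piHat m r = g ^ r := fun r => by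
    induction r with
    | zero => rfl
    | succ r ih =>
      rw [piHat, pow_succ', mul_apply, show (phi m ^ r) 1 = piHat m r from rfl, ih, hphi, pow_succ]
  rw [hpow, hpow, pow_succ', mul_apply]

theorem val_cycleRange_idxC_inv (m : ℕ) (k : Fin (2 * m + 2)) :
    ((Fin.cycleRange (idxC m))⁻¹ k : ℕ) = if (k : ℕ) = 0 then 2 * m + 1 else (k : ℕ) - 1 := by
  obtain ⟨j, rfl⟩ : ∃ j, k = Fin.cycleRange (idxC m) j :=
    ⟨(Fin.cycleRange (idxC m))⁻¹ k, by simp⟩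
  rw [show (Fin.cycleRange (idxC m))⁻¹ (Fin.cycleRange (idxC m) j) = j by simp]
  have hj := j.2
  rcases lt_or_ge (j : ℕ) (2 * m + 1) with h | h
  · rw [Fin.coe_cycleRange_of_lt h, if_neg (Nat.succ_ne_zero _), Nat.add_sub_cancel]
  · have hC : j = idxC m := Fin.ext (by simp only [idxC]; omega)
    rw [hC, Fin.cycleRange_self]
    rfl

theorem val_cycleRange_idxA (m : ℕ) (k : Fin (2 * m + 2)) :
    (Fin.cycleRange (idxA m) k : ℕ) = if (k : ℕ) < 2 * m - 2 then (k : ℕ) + 1 else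
      if (k : ℕ) = 2 * m - 2 then 0 else k := by
  rcases lt_trichotomy (k : ℕ) (2 * m - 2) with h | h | h
  · rw [Fin.coe_cycleRange_of_lt h, if_pos h]
  · have hA : k = idxA m := Fin.ext h
    rw [if_neg h.not_lt, if_pos h, hA, Fin.cycleRange_self]
    rfl
  · rw [Fin.cycleRange_of_gt (Fin.lt_def.2 h), if_neg h.not_gt, if_neg h.ne']

/-- Counting from `0`, the last entry runs through `2m + 1 → 2m - 1 → 2m - 2 → ⋯ → 1 → 2m + 1`, a
cycle of length `2m`. The two inverse rotations subtract `2`; the remaining factor adds `1` below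
`2m - 2` and fixes `2m - 1` and `2m + 1`. -/
theorem val_piHat_idxC (m : ℕ) (hm : 2 ≤ m) (r : ℕ) :
    (piHat m r (idxC m) : ℕ) = if r % (2 * m) = 0 then 2 * m + 1 else 2 * m - r % (2 * m) := by
  induction r with
  | zero => simp [piHat, idxC]
  | succ r ih =>
    have hr : r % (2 * m) < 2 * m := Nat.mod_lt _ (by omega)
    have hs : (r + 1) % (2 * m) = if r % (2 * m) = 2 * m - 1 then 0 else r % (2 * m) + 1 := by
      rw [Nat.add_mod, Nat.mod_eq_of_lt (a := 1) (by omega)]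
      split_ifs with h
      · rw [h, Nat.sub_add_cancel (by omega), Nat.mod_self]
      · exact Nat.mod_eq_of_lt (by omega)
    rw [piHat_succ_apply, mul_apply, mul_apply, val_cycleRange_idxA, val_cycleRange_idxC_inv,
      val_cycleRange_idxC_inv, ih, hs]
    generalize r % (2 * m) = s at *
    clear ih hs
    generalize hv : (if s = 0 then 2 * m + 1 else 2 * m - s) = v
    generalize hv' : (if v = 0 then 2 * m + 1 else v - 1) = v'
    generalize hw : (if v' = 0 then 2 * m + 1 else v' - 1) = w
    generalize hs : (if s = 2 * m - 1 then 0 else s + 1) = s'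
    have hv'0 : v' = v - 1 := by rw [← hv', if_neg (by split_ifs at hv <;> omega)]
    rcases (show s = 2 * m - 1 ∨ s < 2 * m - 1 by omega) with h | h
    · have hv1 : v = 1 := by split_ifs at hv <;> omega
      have hw1 : w = 2 * m + 1 := by rw [← hw, if_pos (by omega)]
      rw [if_pos h] at hs
      rw [if_pos hs.symm, if_neg (by omega), if_neg (by omega), hw1]
    · have hv1 : 2 ≤ v := by split_ifs at hv <;> omega
      have hw1 : w = v - 2 := by rw [← hw, if_neg (by omega)]; omega
      rw [if_neg (by omega)] at hs
      rw [if_neg (by omega : ¬ s' = 0)]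
      split_ifs at hv ⊢ <;> omega

theorem exists_transported_code (m : ℕ) (hm : 2 ≤ m) (π : Perm (Fin (2 * m + 2))) :
    ∃ C : List (Perm (Fin (2 * m + 2))),
      2 * (C.length + (2 * m - 1)) = (2 * m + 1).factorial ∧
      IsPushToTopCode (2 * m + 2) C.length C ∧ ParityPreserving C ∧
      C.head? = some π ∧ C.getLast? = some ((pushToTop (idxA m))⁻¹ π) ∧
      (∀ σ ∈ C, σ (idxC m) = π (idxC m)) ∧ (pushToTop (idxB m))⁻¹ π ∉ C := by
  -- With `q + 4 = 2m + 1`, the permutations `rot q` and `push q` become the transitions on the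
  -- indices `2m + 1` and `2m - 1`.
  obtain ⟨q, hqm⟩ : ∃ q, 2 * m = q + 3 := ⟨2 * m - 3, by omega⟩
  have hq : Odd q := ⟨m - 2, by omega⟩
  have hle : q + 4 ≤ 2 * m + 2 := by omega
  obtain ⟨C, h1, h2, h3, h4, h5, h6, h7⟩ := exists_code hq
  have hrot : firstLetters hle (rot q) = (Fin.cycleRange (idxB m))⁻¹ := by
    rw [rot, map_inv, ← Fin.cycleRange_last, firstLetters_cycleRange]
    congr 2
    exact Fin.ext hqm.symm
  have hpush : firstLetters hle (push q) = (Fin.cycleRange (idxA m))⁻¹ := by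
    rw [push, map_inv, firstLetters_cycleRange]
    congr 2
    exact Fin.ext (by simp only [idxA, Fin.val_castLE]; omega)
  set f : Perm (Fin (q + 4)) → Perm (Fin (2 * m + 2)) := fun x => π * firstLetters hle x with hf
  have hfinj : Function.Injective f := (mul_right_injective π).comp (firstLetters_injective hle)
  have hstepB : ∀ x, f (x * rot q) = pushToTop (idxB m) (f x) := fun x => by
    rw [pushToTop_eq]; simp only [hf]; rw [map_mul, hrot, mul_assoc]
  have hstepA : ∀ x, f (x * push q) = pushToTop (idxA m) (f x) := fun x => by
    rw [pushToTop_eq]; simp only [hf]; rw [map_mul, hpush, mul_assoc]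
  have htA : ∀ x, f (x * push q) = pushToTop (idxA m) (f x) → ∃ t ∈ topTransitions (2 * m + 2),
      f (x * push q) = t (f x) :=
    fun x hx => ⟨_, ⟨idxA m, by simp only [idxA]; omega, rfl⟩, hx⟩
  have hf1 : f 1 = π := by simp [hf]
  have hhead : (C.map f).head? = some π := by rw [List.head?_map, h3, Option.map_some, hf1]
  have hlastA : f (push q)⁻¹ = (pushToTop (idxA m))⁻¹ π := by
    rw [eq_inv_iff_eq, ← hstepA, inv_mul_cancel, hf1]
  have hlast : (C.map f).getLast? = some ((pushToTop (idxA m))⁻¹ π) := by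
    rw [List.getLast?_map, h4, Option.map_some, hlastA]
  have hne : C.map f ≠ [] := by rintro h; rw [h] at hhead; simp at hhead
  refine ⟨C.map f, ?_, ⟨⟨⟨h1.map hfinj, ?_⟩, hne, pushToTop (idxA m),
    ⟨idxA m, by simp only [idxA]; omega, rfl⟩, ?_⟩, rfl⟩, ?_, hhead, hlast, ?_, ?_⟩
  · rw [List.length_map, show 2 * m - 1 = q + 2 by omega, h6, hqm]
  · rw [List.isChain_map]
    refine h2.imp ?_
    rintro x y (rfl | rfl)
    · exact ⟨_, ⟨idxB m, by simp only [idxB]; omega, rfl⟩, hstepB x⟩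
    · exact htA x (hstepA x)
  · rw [List.head?_eq_some_head hne, Option.some_inj] at hhead
    rw [List.getLast?_eq_some_getLast hne, Option.some_inj] at hlast
    rw [hhead, hlast]
    simp
  · intro σ hσ τ hτ
    obtain ⟨x, hx, rfl⟩ := List.mem_map.1 hσ
    obtain ⟨y, hy, rfl⟩ := List.mem_map.1 hτ
    simp only [hf, Perm.sign_mul, sign_firstLetters, h5 x hx, h5 y hy]
  · intro σ hσ
    obtain ⟨x, hx, rfl⟩ := List.mem_map.1 hσ
    simp only [hf, mul_apply]
    rw [firstLetters_of_le hle x (by simp only [idxC]; omega)]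
  · intro h
    obtain ⟨x, hx, hxe⟩ := List.mem_map.1 h
    have hB : f (rot q)⁻¹ = (pushToTop (idxB m))⁻¹ π := by
      rw [eq_inv_iff_eq, ← hstepB, inv_mul_cancel, hf1]
    rw [← hB] at hxe
    exact h7 (hfinj hxe ▸ hx)

end Transport

end RankMod

theorem mainTheorem6 (m : ℕ) (hm : 2 ≤ m) (r : ℕ) :
    (∃ (M : ℕ) (C : List (Equiv.Perm (Fin (2 * m + 2)))),
      (M : ℚ) = (Nat.factorial (2 * m + 1) : ℚ) / 2 - (2 * (m : ℚ) - 1) ∧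
      RankMod.IsPushToTopCode (2 * m + 2) M C ∧
      RankMod.ParityPreserving C ∧
      C.head? = some (RankMod.piHat m r) ∧
      C.getLast? = some ((RankMod.pushToTop (RankMod.idxA m))⁻¹ (RankMod.piHat m r)) ∧
      (∀ π ∈ C, π (RankMod.idxC m) = RankMod.piHat m r (RankMod.idxC m)) ∧
      RankMod.sigmaTilde m r ∉ C) ∧
    -- the value of the last entry, in `{1, …, 2m + 2}`
    ((RankMod.piHat m r (RankMod.idxC m) : ℕ) : ℤ) + 1 =
      (if r % (2 * m) = 0 then 2 * (m : ℤ) + 2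
        else 2 * (m : ℤ) + 1 - ((r % (2 * m) : ℕ) : ℤ)) ∧
    RankMod.sigmaTilde m r =
      (RankMod.pushToTop (RankMod.idxB m))⁻¹ (RankMod.piHat m r) ∧
    RankMod.sigmaTilde m r (RankMod.idxC m) = RankMod.piHat m r (RankMod.idxC m) := by
  obtain ⟨C, hlen, hC, hpar, hhead, hlast, hend, hmiss⟩ :=
    RankMod.exists_transported_code m hm (RankMod.piHat m r)
  have hsig := RankMod.sigmaTilde_eq m r
  refine ⟨⟨C.length, C, ?_, hC, hpar, hhead, hlast, hend, hsig ▸ hmiss⟩, ?_, hsig, ?_⟩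
  · rw [← hlen]
    push_cast [Nat.cast_sub (show 1 ≤ 2 * m by omega)]
    ring
  · rw [RankMod.val_piHat_idxC m hm r]
    have hr : r % (2 * m) < 2 * m := Nat.mod_lt _ (by omega)
    split_ifs <;> omega
  · rw [hsig, RankMod.pushToTop_inv_eq, Equiv.Perm.mul_apply,
      Fin.cycleRange_of_gt (Fin.lt_def.2 (by simp [RankMod.idxB, RankMod.idxC]))]
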